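/- Let $m\ge 0$, $0<\alpha_m\le\dots\le\alpha_1<\alpha<1$, $b_1,\dots,b_m>0$ and $T>0$, and set $$P(\partial_t)=\partial_t^{\alpha}+\sum_{i=1}^m b_i\,\partial_t^{\alpha_i},\qquad \partial_t^\beta u(t)=\frac1{\Gamma(1-\beta)}\int_0^t(t-\tau)^{-\beta}u'(\tau)\,d\tau$$ (Caputo derivatives). Let $\Omega\subset\mathbb R^d$, $d\in\{1,2,3\}$, be a bounded convex polygonal domain, and let $\{\lambda_j\}_{j\ge1}$ and $\{\varphi_j\}_{j\ge1}$ be the eigenvalues (with multiplicity) and the $L^2(\Omega)$-orthonormal eigenfunctions of $-\Delta$ on $\Omega$ with homogeneous Dirichlet boundary condition. For real $s$ and $v\in H^{-1}(\Omega)$ put $$\|v\|_{\dot H^s}^2=\sum_{j=1}^\infty\lambda_j^s\langle v,\varphi_j\rangle^2,\qquad \dot H^s=\{v\in H^{-1}(\Omega):\|v\|_{\dot H^s}<\infty\}.$$ For $\vec\beta=(\beta_1,\dots,\beta_n)$ let $$E_{\vec\beta,\beta_0}(z_1,\dots,z_n)=\sum_{k=0}^\infty\ \sum_{l_1+\dots+l_n=k}\frac{k!}{l_1!\cdots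 l_n!}\,\frac{\prod_{i=1}^n z_i^{l_i}}{\Gamma(\beta_0+\sum_{i=1}^n\beta_il_i)}$$ be the multinomial Mittag-Leffler function and, with $\vec\alpha=(\alpha,\alpha-\alpha_1,\dots,\alpha-\alpha_m)$, define $$E(t)v=\sum_{j=1}^\infty\Big(1-\lambda_jt^\alpha E_{\vec\alpha,1+\alpha}(-\lambda_jt^\alpha,-b_1t^{\alpha-\alpha_1},\dots,-b_mt^{\alpha-\alpha_m})\Big)\langle v,\varphi_j\rangle\varphi_j .$$ Then there is a constant $C>0$, depending only on $\alpha,\alpha_1,\dots,\alpha_m,b_1,\dots,b_m$ and $T$, such that for every $q\in(-1,2]$ and $v\in\dot H^q$ the following holds. For $0<t\le T$ the series for $u(t)=E(t)v$ converges in $H^{-1}(\Omega)$; $u(t)\in H^1_0(\Omega)$; the Caputo derivatives of orders $\alpha,\alpha_1,\dots,\alpha_m$ of $u$ exist at $t$ as Bochner integrals in $H^{-1}(\Omega)$; and $P(\partial_t)u(t)-\Delta u(t)=0$ in $H^{-1}(\Omega)$. Moreover $P(\partial_t)^\ell u(t)\in\dot H^p$ and $$\|P(\partial_t)^\ell u(t)\|_{\dot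 H^p}\le C\,t^{-\alpha(\ell+(p-q)/2)}\,\|v\|_{\dot H^q},\qquad 0<t\le T,$$ for $\ell=0$ and all real $p$ with $0\le p-q\le2$, and for $\ell=1$ and all real $p$ with $-2\le p-q\le0$. Finally, the initial condition holds in the sense that $u(t)-v\in\dot H^q$ for $0<t\le T$ and $\lim_{t\to0^+}\|u(t)-v\|_{\dot H^q}=0$. -/

import Mathlib

open MeasureTheory Filter Topology Set
open scoped ContDiff RealInnerProductSpace

noncomputable section

namespace MultiTermDiffusion

/-! ### Domains and the spaces `H¹₀(Ω)`, `H⁻¹(Ω)` -/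

/-- A bounded convex polygonal (polyhedral) domain: the nonempty interior of the convex hull of
finitely many points. -/
def IsConvexPolygonalDomain {d : ℕ} (Ω : Set (EuclideanSpace ℝ (Fin d))) : Prop :=
  Ω.Nonempty ∧
    ∃ S : Set (EuclideanSpace ℝ (Fin d)), S.Finite ∧ Ω = interior (convexHull ℝ S)

/-- `L²(Ω)`. -/
abbrev L2 {d : ℕ} (Ω : Set (EuclideanSpace ℝ (Fin d))) : Type :=
  Lp ℝ 2 (volume.restrict Ω)

/-- `L²(Ω; ℝᵈ)`. -/
abbrev L2Vec {d : ℕ} (Ω : Set (EuclideanSpace ℝ (Fin d))) : Type :=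
  Lp (EuclideanSpace ℝ (Fin d)) 2 (volume.restrict Ω)

/-- The pairs `(ψ, ∇ψ)` in `L²(Ω) × L²(Ω; ℝᵈ)` with `ψ ∈ C_c^∞(Ω)`. -/
def testGraph {d : ℕ} (Ω : Set (EuclideanSpace ℝ (Fin d))) :
    Set (WithLp 2 (L2 Ω × L2Vec Ω)) :=
  {w | ∃ ψ : EuclideanSpace ℝ (Fin d) → ℝ,
    ContDiff ℝ ∞ ψ ∧ HasCompactSupport ψ ∧ tsupport ψ ⊆ Ω ∧
    (w.fst : EuclideanSpace ℝ (Fin d) → ℝ) =ᵐ[volume.restrict Ω] ψ ∧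
    (w.snd : EuclideanSpace ℝ (Fin d) → EuclideanSpace ℝ (Fin d))
      =ᵐ[volume.restrict Ω] gradient ψ}

/-- `H¹₀(Ω)`, the closure of `C_c^∞(Ω)` in the norm `(‖ψ‖² + ‖∇ψ‖²)^{1/2}`; an element is
recorded together with its weak gradient. -/
abbrev H10 {d : ℕ} (Ω : Set (EuclideanSpace ℝ (Fin d))) :
    Submodule ℝ (WithLp 2 (L2 Ω × L2Vec Ω)) :=
  (Submodule.span ℝ (testGraph Ω)).topologicalClosure

/-- The inclusion `H¹₀(Ω) → L²(Ω)`. -/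
def toL2 {d : ℕ} (Ω : Set (EuclideanSpace ℝ (Fin d))) : H10 Ω →L[ℝ] L2 Ω :=
  (WithLp.fstL 2 ℝ (L2 Ω) (L2Vec Ω)).comp (H10 Ω).subtypeL

/-- The weak gradient `H¹₀(Ω) → L²(Ω; ℝᵈ)`. -/
def grad {d : ℕ} (Ω : Set (EuclideanSpace ℝ (Fin d))) : H10 Ω →L[ℝ] L2Vec Ω :=
  (WithLp.sndL 2 ℝ (L2 Ω) (L2Vec Ω)).comp (H10 Ω).subtypeL

/-- `H⁻¹(Ω)`, the dual of `H¹₀(Ω)`. -/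
abbrev HNegOne {d : ℕ} (Ω : Set (EuclideanSpace ℝ (Fin d))) : Type :=
  StrongDual ℝ (H10 Ω)

/-- The embedding `H¹₀(Ω) ⊂ L²(Ω) ⊂ H⁻¹(Ω)`, `⟨w, χ⟩ = (w, χ)_{L²}`. -/
def embed {d : ℕ} {Ω : Set (EuclideanSpace ℝ (Fin d))} (w : H10 Ω) : HNegOne Ω :=
  (innerSL ℝ (toL2 Ω w)).comp (toL2 Ω)

/-- The weak Dirichlet Laplacian `Δ : H¹₀(Ω) → H⁻¹(Ω)`, `⟨Δw, χ⟩ = -(∇w, ∇χ)_{L²}`. -/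
def laplacian {d : ℕ} {Ω : Set (EuclideanSpace ℝ (Fin d))} (w : H10 Ω) : HNegOne Ω :=
  -(innerSL ℝ (grad Ω w)).comp (grad Ω)

/-! ### Dirichlet eigenfunctions and the spaces `Ḣˢ(Ω)` -/

/-- `-Δw = μ w` weakly, with zero Dirichlet boundary condition. -/
def IsDirichletEigenpair {d : ℕ} {Ω : Set (EuclideanSpace ℝ (Fin d))}
    (μ : ℝ) (w : H10 Ω) : Prop :=
  w ≠ 0 ∧ -laplacian w = μ • embed w

/-- `(lam j)` are the eigenvalues of the Dirichlet Laplacian `-Δ`, counted with multiplicity, and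
`(φ j)` are corresponding `L²(Ω)`-orthonormal eigenfunctions; `exhaustive` says that no
eigenfunction has been left out. -/
structure IsDirichletEigensystem {d : ℕ} (Ω : Set (EuclideanSpace ℝ (Fin d)))
    (lam : ℕ → ℝ) (φ : ℕ → H10 Ω) : Prop where
  orthonormal : Orthonormal ℝ (fun j => toL2 Ω (φ j))
  eigenpair : ∀ j, IsDirichletEigenpair (lam j) (φ j)
  exhaustive : ∀ (μ : ℝ) (w : H10 Ω), IsDirichletEigenpair μ w →
    ∃ j, ⟪toL2 Ω (φ j), toL2 Ω w⟫ ≠ 0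

/-- `v ∈ Ḣˢ(Ω)`: the element `v` of `H⁻¹(Ω)` satisfies `∑ⱼ λⱼˢ ⟨v, φⱼ⟩² < ∞`. -/
def MemDotH {d : ℕ} {Ω : Set (EuclideanSpace ℝ (Fin d))} (lam : ℕ → ℝ) (φ : ℕ → H10 Ω)
    (s : ℝ) (v : HNegOne Ω) : Prop :=
  Summable fun j => lam j ^ s * (v (φ j)) ^ 2

/-- The norm `‖v‖ = (∑ⱼ λⱼˢ ⟨v, φⱼ⟩²)^{1/2}` of `Ḣˢ(Ω)`. -/
def dotHNorm {d : ℕ} {Ω : Set (EuclideanSpace ℝ (Fin d))} (lam : ℕ → ℝ) (φ : ℕ → H10 Ω)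
    (s : ℝ) (v : HNegOne Ω) : ℝ :=
  Real.sqrt (∑' j, lam j ^ s * (v (φ j)) ^ 2)

/-! ### Multinomial Mittag-Leffler function and solution operator -/

/-- The multinomial Mittag-Leffler function `E_{(β₁,…,βₙ),β₀}(z₁,…,zₙ)` at real arguments. -/
def multinomialML {n : ℕ} (β : Fin n → ℝ) (β₀ : ℝ) (z : Fin n → ℝ) : ℝ :=
  ∑' k : ℕ, ∑ l ∈ Finset.piAntidiag (Finset.univ : Finset (Fin n)) k,
    (Nat.multinomial Finset.univ l : ℝ) * (∏ i, z i ^ l i) / Real.Gamma (β₀ + ∑ i, β i * l i)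

/-- The factor
`1 - λ t^α E_{(α,α-α₁,…,α-αₘ),1+α}(-λ t^α, -b₁ t^{α-α₁}, …, -bₘ t^{α-αₘ})`. -/
def modeFactor {m : ℕ} (α : ℝ) (αs b : Fin m → ℝ) (lam t : ℝ) : ℝ :=
  1 - lam * t ^ α *
    multinomialML (Fin.cons α (fun i => α - αs i) : Fin (m + 1) → ℝ) (1 + α)
      (Fin.cons (-(lam * t ^ α)) (fun i => -(b i * t ^ (α - αs i))) : Fin (m + 1) → ℝ)

/-- The `j`-th term of the series defining `E(t)v`. -/
def solTerm {d : ℕ} {Ω : Set (EuclideanSpace ℝ (Fin d))} {m : ℕ} (α : ℝ) (αs b : Fin m → ℝ)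
    (lam : ℕ → ℝ) (φ : ℕ → H10 Ω) (v : HNegOne Ω) (t : ℝ) (j : ℕ) : HNegOne Ω :=
  (modeFactor α αs b (lam j) t * v (φ j)) • embed (φ j)

/-- The solution operator `E(t)v`, the series being summed in `H⁻¹(Ω)`. -/
def solOp {d : ℕ} {Ω : Set (EuclideanSpace ℝ (Fin d))} {m : ℕ} (α : ℝ) (αs b : Fin m → ℝ)
    (lam : ℕ → ℝ) (φ : ℕ → H10 Ω) (v : HNegOne Ω) (t : ℝ) : HNegOne Ω :=
  ∑' j, solTerm α αs b lam φ v t j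

/-! ### Caputo derivatives of vector-valued functions -/

/-- The integral that defines the Caputo derivative of order `β` of `u` at `t` makes sense. -/
def CaputoDifferentiableAt {F : Type*} [NormedAddCommGroup F] [NormedSpace ℝ F]
    (β : ℝ) (u : ℝ → F) (t : ℝ) : Prop :=
  (∀ τ ∈ Ioo 0 t, DifferentiableAt ℝ u τ) ∧
    IntervalIntegrable (fun τ => (t - τ) ^ (-β) • deriv u τ) volume 0 t

/-- The left-sided Caputo derivative `Γ(1-β)⁻¹ ∫₀ᵗ (t-τ)^{-β} u'(τ) dτ`. -/
def caputoDeriv {F : Type*} [NormedAddCommGroup F] [NormedSpace ℝ F]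
    (β : ℝ) (u : ℝ → F) (t : ℝ) : F :=
  (Real.Gamma (1 - β))⁻¹ • ∫ τ in (0 : ℝ)..t, (t - τ) ^ (-β) • deriv u τ

/-- `P(∂ₜ)u = ∂ₜ^α u + ∑ᵢ bᵢ ∂ₜ^{αᵢ} u`. -/
def multiTermDeriv {F : Type*} [NormedAddCommGroup F] [NormedSpace ℝ F] {m : ℕ}
    (α : ℝ) (αs b : Fin m → ℝ) (u : ℝ → F) (t : ℝ) : F :=
  caputoDeriv α u t + ∑ i, b i • caputoDeriv (αs i) u t

/-- On `(0, T]` the function `u` satisfies `P(∂ₜ)u - Δu = 0` in `H⁻¹(Ω)` with `u(t) ∈ H¹₀(Ω)`, all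
the Caputo derivatives existing. -/
def SolvesHomogeneous {d : ℕ} {Ω : Set (EuclideanSpace ℝ (Fin d))} {m : ℕ}
    (α : ℝ) (αs b : Fin m → ℝ) (T : ℝ) (u : ℝ → HNegOne Ω) : Prop :=
  ∀ t ∈ Ioc 0 T,
    CaputoDifferentiableAt α u t ∧ (∀ i, CaputoDifferentiableAt (αs i) u t) ∧
    ∃ w : H10 Ω, embed w = u t ∧ multiTermDeriv α αs b u t - laplacian w = 0

end MultiTermDiffusion

end

namespace MultiTermDiffusion

/-! ### Beta integrals -/

/-! The problem decouples along eigenfunctions: the factor `y` multiplying the mode with eigenvalue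
`λ` solves `P(∂ₜ)y + λy = 0`, `y(0) = 1`. Everything follows from bounds on `y` and `y'` that are
explicit in `λ`, and these come from a maximum principle, without Laplace transforms or contour
integrals.

The equation is proved on series. After multiplication by `t^μ`, the multinomial Mittag-Leffler
function is a generalized power series in `t`; Caputo derivatives act on it termwise
(`IsEntireSeries.caputoDeriv_eq`), and the multinomial recurrence (`mlSeries_zero`) is exactly the
equation.

For the bounds, a Caputo derivative is nonnegative where a function attains its maximum over the
past (`caputoDeriv_nonneg_of_max`). Hence `y ≥ 0`. The function `G = t y'` satisfies `P(∂ₜ)G + λG =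
α ∂^α y + ∑ αᵢ bᵢ ∂^{αᵢ} y`, and looking at a first zero of `G` gives `y' < 0`. Then `∂^{αᵢ} y ≤ 0`
and `αᵢ < α` bound the right side below by `α P(∂ₜ)y = -αλy`, so comparison with a constant and with
a multiple of `t^α` yields `-G ≤ α` and `-G ≤ cλt^α`. The first bound and `0 ≤ y ≤ 1` give `-∂^β y ≤
c t^{-β}` (`neg_caputoDeriv_le`), and the equation turns this into `λy ≤ C t^{-α}` with `C`
independent of `λ`. Interpolation with `y ≤ 1` produces the smoothing estimates for both `ℓ = 0` and
`ℓ = 1`, since `P(∂ₜ)` acts on a mode as `-λ`.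

To work in `H⁻¹(Ω)`, the Riesz isomorphism `1 - Δ` and the eigenfunctions normalized in `H¹₀(Ω)`
represent `u(t)` isometrically by an `ℓ²` sequence. The interpolated bound `|y'| ≤ Mλ^θ t^{αθ-1}`
with `θ = min(1, (1+q)/2)` lets one differentiate and integrate in `ℓ²`; `q > -1` makes `t^{αθ-1}`
integrable at `0`. -/

theorem intervalIntegrable_rpow_mul_sub_rpow {a b t : ℝ} (ha : 0 < a) (hb : 0 < b) (ht : 0 < t) :
    IntervalIntegrable (fun τ : ℝ => (t - τ) ^ (b - 1) * τ ^ (a - 1)) volume 0 t := by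
  have h2 : IntervalIntegrable (fun τ : ℝ => τ ^ (a - 1)) volume 0 t :=
    intervalIntegral.intervalIntegrable_rpow' (by linarith)
  have h3 : IntervalIntegrable (fun τ : ℝ => (t - τ) ^ (b - 1)) volume 0 t := by
    have := (intervalIntegral.intervalIntegrable_rpow' (a := t) (b := 0) (r := b - 1)
      (by linarith)).comp_sub_left t
    simpa using this
  -- Cutting at `t/2` leaves one singular factor on each half; the other factor is continuous there.
  have hleft : IntervalIntegrable (fun τ : ℝ => (t - τ) ^ (b - 1) * τ ^ (a - 1))
      volume 0 (t / 2) := by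
    refine (h2.mono_set ?_).continuousOn_mul ?_
    · rw [uIcc_of_le (by linarith), uIcc_of_le (by linarith)]
      exact Icc_subset_Icc_right (by linarith)
    · rw [uIcc_of_le (by linarith)]
      refine ContinuousOn.rpow_const (by fun_prop) fun x hx => Or.inl ?_
      have := hx.2
      linarith
  have hright : IntervalIntegrable (fun τ : ℝ => (t - τ) ^ (b - 1) * τ ^ (a - 1))
      volume (t / 2) t := by
    refine (h3.mono_set ?_).mul_continuousOn ?_
    · rw [uIcc_of_le (by linarith), uIcc_of_le (by linarith)]
      exact Icc_subset_Icc_left (by linarith)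
    · rw [uIcc_of_le (by linarith)]
      refine ContinuousOn.rpow_const (by fun_prop) fun x hx => Or.inl ?_
      have := hx.1
      linarith
  exact hleft.trans hright

theorem integral_rpow_mul_sub_rpow {a b t : ℝ} (ha : 0 < a) (hb : 0 < b) (ht : 0 < t) :
    ∫ τ in (0 : ℝ)..t, (t - τ) ^ (b - 1) * τ ^ (a - 1)
      = Real.Gamma a * Real.Gamma b / Real.Gamma (a + b) * t ^ (a + b - 1) := by
  have h := Complex.betaIntegral_scaled (a : ℂ) (b : ℂ) ht
  rw [Complex.betaIntegral_eq_Gamma_mul_div _ _ (by simpa using ha) (by simpa using hb)] at h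
  have h1 : ∫ x in (0 : ℝ)..t, (x : ℂ) ^ ((a : ℂ) - 1) * ((t : ℂ) - x) ^ ((b : ℂ) - 1)
      = ((∫ τ in (0 : ℝ)..t, (t - τ) ^ (b - 1) * τ ^ (a - 1) : ℝ) : ℂ) := by
    rw [← intervalIntegral.integral_ofReal]
    refine intervalIntegral.integral_congr fun x hx => ?_
    rw [uIcc_of_le ht.le] at hx
    have h2 : (0 : ℝ) ≤ t - x := by linarith [hx.2]
    rw [Complex.ofReal_mul, Complex.ofReal_cpow h2, Complex.ofReal_cpow hx.1]
    push_cast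
    ring
  rw [h1] at h
  have h3 : ((t : ℂ) ^ ((a : ℂ) + b - 1)) = ((t ^ (a + b - 1) : ℝ) : ℂ) := by
    rw [Complex.ofReal_cpow ht.le]; push_cast; rfl
  rw [h3, ← Complex.ofReal_add, Complex.Gamma_ofReal, Complex.Gamma_ofReal, Complex.Gamma_ofReal] at h
  have h4 : ((∫ τ in (0 : ℝ)..t, (t - τ) ^ (b - 1) * τ ^ (a - 1) : ℝ) : ℂ) =
      ((t ^ (a + b - 1) * (Real.Gamma a * Real.Gamma b / Real.Gamma (a + b)) : ℝ) : ℂ) := by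
    rw [h]; push_cast; rfl
  rw [Complex.ofReal_inj.mp h4]
  ring

/-! ### Generalized power series -/

/-- `∑ aᵢ t^{γᵢ}` is a generalized power series with nonnegative exponents which converges
absolutely for all `t > 0`. -/
structure IsEntireSeries {ι : Type*} (a γ : ι → ℝ) : Prop where
  nonneg : ∀ i, 0 ≤ γ i
  summable : ∀ R : ℝ, 0 < R → Summable fun i => |a i| * R ^ γ i

/-- The sum of a generalized power series. -/
noncomputable def gseries {ι : Type*} (a γ : ι → ℝ) (t : ℝ) : ℝ := ∑' i, a i * t ^ γ i

section Series

variable {ι : Type*} {a γ : ι → ℝ}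

theorem IsEntireSeries.summable_apply (h : IsEntireSeries a γ) {t : ℝ} (ht : 0 < t) :
    Summable fun i => a i * t ^ γ i := by
  refine Summable.of_norm ?_
  simpa [abs_mul, abs_of_nonneg (Real.rpow_nonneg ht.le _)] using h.summable t ht

/-- Since `γ ≤ e^γ`, the extra factor `γ` is absorbed by evaluating the original series at `eR`. The
new series is `t` times the derivative of the old one. -/
theorem IsEntireSeries.mul_exponent (h : IsEntireSeries a γ) :
    IsEntireSeries (fun i => a i * γ i) γ := by
  refine ⟨h.nonneg, fun R hR => ?_⟩
  refine Summable.of_nonneg_of_le (fun i => by positivity) (fun i => ?_)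
    (h.summable (Real.exp 1 * R) (by positivity))
  rw [Real.mul_rpow (Real.exp_pos 1).le hR.le, abs_mul, abs_of_nonneg (h.nonneg i), mul_assoc]
  have h1 : γ i ≤ Real.exp 1 ^ γ i := by
    rw [← Real.exp_mul, one_mul]
    linarith [Real.add_one_le_exp (γ i)]
  gcongr

theorem IsEntireSeries.hasDerivAt (h : IsEntireSeries a γ) {t : ℝ} (ht : 0 < t) :
    HasDerivAt (gseries a γ) (t⁻¹ * gseries (fun i => a i * γ i) γ t) t := by
  have hs := (h.mul_exponent.summable (2 * t) (by positivity)).mul_left (2 / t)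
  have key := hasDerivAt_tsum_of_isPreconnected (t := Ioo (t / 2) (2 * t)) (y₀ := t)
    (g := fun i s => a i * s ^ γ i) (g' := fun i s => a i * (γ i * s ^ (γ i - 1))) (y := t)
    hs isOpen_Ioo isPreconnected_Ioo (fun i s hs => ?_) (fun i s hs => ?_)
    ⟨by linarith, by linarith⟩ (h.summable_apply ht) ⟨by linarith, by linarith⟩
  · refine HasDerivAt.congr_deriv key ?_
    rw [gseries, ← tsum_mul_left]
    refine tsum_congr fun i => ?_
    rw [Real.rpow_sub_one ht.ne']
    field_simp
  · have h0 : 0 < s := by linarith [hs.1]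
    exact (Real.hasDerivAt_rpow_const (Or.inl h0.ne')).const_mul (a i)
  · have h0 : 0 < s := by linarith [hs.1]
    rw [Real.rpow_sub_one h0.ne', Real.norm_eq_abs, abs_mul, abs_mul, abs_mul, abs_div,
      abs_of_pos h0, abs_of_nonneg (Real.rpow_nonneg h0.le (γ i))]
    have h1 : s ^ γ i / s ≤ (2 / t) * (2 * t) ^ γ i := by
      rw [div_eq_inv_mul]
      have h2 : s⁻¹ ≤ 2 / t := by
        rw [inv_le_comm₀ h0 (by positivity), inv_div]; exact hs.1.le
      have h3 : s ^ γ i ≤ (2 * t) ^ γ i := Real.rpow_le_rpow h0.le hs.2.le (h.nonneg i)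
      gcongr
    calc |a i| * (|γ i| * (s ^ γ i / s)) ≤ |a i| * (|γ i| * ((2 / t) * (2 * t) ^ γ i)) := by gcongr
      _ = _ := by ring

theorem IsEntireSeries.deriv (h : IsEntireSeries a γ) {t : ℝ} (ht : 0 < t) :
    deriv (gseries a γ) t = t⁻¹ * gseries (fun i => a i * γ i) γ t :=
  (h.hasDerivAt ht).deriv

theorem IsEntireSeries.continuousOn (h : IsEntireSeries a γ) {R : ℝ} (hR : 0 < R) :
    ContinuousOn (gseries a γ) (Icc 0 R) := by
  refine continuousOn_tsum (fun i => ?_) (h.summable R hR) fun i s hs => ?_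
  · exact continuousOn_const.mul (continuousOn_id.rpow_const fun x _ => Or.inr (h.nonneg i))
  · rw [Real.norm_eq_abs, abs_mul, abs_of_nonneg (Real.rpow_nonneg hs.1 _)]
    have := Real.rpow_le_rpow hs.1 hs.2 (h.nonneg i)
    gcongr

theorem gseries_zero (hγ : ∀ i, 0 < γ i) : gseries a γ 0 = 0 := by
  simp [gseries, Real.zero_rpow (ne_of_gt (hγ _))]

/-! ### Caputo derivatives of generalized power series -/

/-- The factor `Γ(γ+1)/Γ(γ+1-β)` by which the Caputo derivative of order `β` acts on `t^γ`. -/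
noncomputable def caputoFactor (β γ : ℝ) : ℝ := Real.Gamma (γ + 1) / Real.Gamma (γ + 1 - β)

theorem caputoFactor_nonneg {β γ : ℝ} (hγ : 0 ≤ γ) (hβ : β < 1) : 0 ≤ caputoFactor β γ :=
  div_nonneg (Real.Gamma_pos_of_pos (by linarith)).le (Real.Gamma_pos_of_pos (by linarith)).le

theorem integral_sub_rpow_mul_deriv_rpow {β γ t : ℝ} (hγ : 0 < γ) (hβ : β < 1) (ht : 0 < t) :
    ∫ τ in (0 : ℝ)..t, (t - τ) ^ (-β) * (γ * τ ^ (γ - 1))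
      = Real.Gamma (1 - β) * (caputoFactor β γ * t ^ (γ - β)) := by
  have h := integral_rpow_mul_sub_rpow hγ (b := 1 - β) (by linarith) ht
  have h1 : (fun τ : ℝ => (t - τ) ^ (-β) * (γ * τ ^ (γ - 1)))
      = fun τ => γ * ((t - τ) ^ (1 - β - 1) * τ ^ (γ - 1)) := by
    funext τ
    rw [show 1 - β - 1 = -β by ring]
    ring
  rw [h1, intervalIntegral.integral_const_mul, h, caputoFactor, Real.Gamma_add_one hγ.ne',
    show γ + (1 - β) = γ + 1 - β by ring, show γ + 1 - β - 1 = γ - β by ring]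
  ring

theorem sub_rpow_mul_deriv_rpow_le {β γ γ₀ t τ : ℝ} (hγ₀ : 0 < γ₀) (hγ : γ₀ ≤ γ)
    (hτ : 0 < τ) (hτt : τ ≤ t) :
    (t - τ) ^ (-β) * (γ * τ ^ (γ - 1))
      ≤ γ * t ^ (γ - γ₀) * ((t - τ) ^ (1 - β - 1) * τ ^ (γ₀ - 1)) := by
  have h1 : τ ^ (γ - 1) ≤ t ^ (γ - γ₀) * τ ^ (γ₀ - 1) := by
    rw [show γ - 1 = (γ - γ₀) + (γ₀ - 1) by ring, Real.rpow_add hτ]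
    have := Real.rpow_le_rpow hτ.le hτt (sub_nonneg.2 hγ)
    gcongr
  have h2 : 0 ≤ (t - τ) ^ (-β) := Real.rpow_nonneg (by linarith) _
  have h3 : 0 ≤ γ := by linarith
  rw [show 1 - β - 1 = -β by ring]
  calc (t - τ) ^ (-β) * (γ * τ ^ (γ - 1))
      ≤ (t - τ) ^ (-β) * (γ * (t ^ (γ - γ₀) * τ ^ (γ₀ - 1))) := by gcongr
    _ = _ := by ring

/-- Dominated convergence: the uniform lower bound `γ₀ > 0` on the exponents gives `τ^(γ-1) ≤
t^(γ-γ₀) τ^(γ₀-1)`, so all terms share one integrable Beta kernel and only a convergent numerical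
series is left. -/
theorem hasSum_caputo [Countable ι] (h : IsEntireSeries a γ) {γ₀ β t : ℝ} (hγ₀ : 0 < γ₀)
    (hγ : ∀ i, γ₀ ≤ γ i) (hβ : β < 1) (ht : 0 < t) :
    HasSum (fun i => a i * (Real.Gamma (1 - β) * (caputoFactor β (γ i) * t ^ (γ i - β))))
      (∫ τ in (0 : ℝ)..t, (t - τ) ^ (-β) * deriv (gseries a γ) τ) := by
  have hb : IntervalIntegrable (fun τ : ℝ => (t - τ) ^ (1 - β - 1) * τ ^ (γ₀ - 1)) volume 0 t :=
    intervalIntegrable_rpow_mul_sub_rpow hγ₀ (by linarith) ht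
  have hs : Summable fun i => |a i * γ i| * t ^ (γ i - γ₀) := by
    refine ((h.mul_exponent.summable t ht).mul_right (t ^ (-γ₀))).congr fun i => ?_
    rw [sub_eq_add_neg, Real.rpow_add ht, mul_assoc]
  have key := intervalIntegral.hasSum_integral_of_dominated_convergence (μ := volume) (a := 0) (b := t)
    (F := fun i τ => a i * ((t - τ) ^ (-β) * (γ i * τ ^ (γ i - 1))))
    (f := fun τ => (t - τ) ^ (-β) * _root_.deriv (gseries a γ) τ)
    (fun i τ => |a i * γ i| * t ^ (γ i - γ₀) * ((t - τ) ^ (1 - β - 1) * τ ^ (γ₀ - 1)))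
    (fun i => ?_) (fun i => ?_) ?_ ?_ ?_
  · refine HasSum.congr_fun key fun i => ?_
    rw [intervalIntegral.integral_const_mul,
      integral_sub_rpow_mul_deriv_rpow (hγ₀.trans_le (hγ i)) hβ ht]
  · refine Measurable.aestronglyMeasurable ?_
    fun_prop
  · refine ae_of_all _ fun τ hτ => ?_
    rw [uIoc_of_le ht.le] at hτ
    have h0 := h.nonneg i
    have h1 : 0 ≤ (t - τ) ^ (-β) := Real.rpow_nonneg (by linarith [hτ.2]) _
    have h2 : 0 ≤ τ ^ (γ i - 1) := Real.rpow_nonneg hτ.1.le _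
    rw [Real.norm_eq_abs, abs_mul, abs_of_nonneg (a := (t - τ) ^ (-β) * _) (by positivity), abs_mul,
      abs_of_nonneg h0]
    have := sub_rpow_mul_deriv_rpow_le (β := β) hγ₀ (hγ i) hτ.1 hτ.2
    calc _ ≤ |a i| * _ := mul_le_mul_of_nonneg_left this (abs_nonneg _)
      _ = _ := by ring
  · exact ae_of_all _ fun τ hτ => hs.mul_right _
  · simp_rw [tsum_mul_right]
    exact hb.const_mul _
  · refine ae_of_all _ fun τ hτ => ?_
    rw [uIoc_of_le ht.le] at hτ
    rw [h.deriv hτ.1]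
    have := ((h.mul_exponent.summable_apply hτ.1).hasSum.mul_left τ⁻¹).mul_left ((t - τ) ^ (-β))
    refine HasSum.congr_fun this fun i => ?_
    rw [Real.rpow_sub_one hτ.1.ne']
    field_simp

/-- Serves both the scalar series and the `ℓ²`-valued solution; in each case the derivative is
controlled by a power `τ^(γ₀-1)` integrable at `0`. -/
theorem intervalIntegrable_sub_rpow_smul {F : Type*} [NormedAddCommGroup F] [NormedSpace ℝ F]
    {f : ℝ → F} {β γ₀ t M : ℝ} (hγ₀ : 0 < γ₀) (hβ : β < 1) (ht : 0 < t)
    (hf : AEStronglyMeasurable f (volume.restrict (Ioc 0 t)))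
    (hM : ∀ τ ∈ Ioo 0 t, ‖f τ‖ ≤ M * τ ^ (γ₀ - 1)) :
    IntervalIntegrable (fun τ => (t - τ) ^ (-β) • f τ) volume 0 t := by
  have hb : IntervalIntegrable (fun τ : ℝ => M * ((t - τ) ^ (1 - β - 1) * τ ^ (γ₀ - 1)))
      volume 0 t :=
    (intervalIntegrable_rpow_mul_sub_rpow hγ₀ (by linarith) ht).const_mul M
  refine hb.mono_fun' ?_ ?_
  · rw [uIoc_of_le ht.le]
    exact (Measurable.aestronglyMeasurable (by fun_prop)).smul hf
  · rw [uIoc_of_le ht.le, ← restrict_Ioo_eq_restrict_Ioc]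
    refine (ae_restrict_mem measurableSet_Ioo).mono fun τ hτ => ?_
    have h1 : 0 ≤ (t - τ) ^ (-β) := Real.rpow_nonneg (by linarith [hτ.2]) _
    beta_reduce
    rw [norm_smul, Real.norm_of_nonneg h1, show 1 - β - 1 = -β by ring]
    calc _ ≤ (t - τ) ^ (-β) * (M * τ ^ (γ₀ - 1)) := mul_le_mul_of_nonneg_left (hM τ hτ) h1
      _ = _ := by ring

theorem IsEntireSeries.norm_deriv_le (h : IsEntireSeries a γ) {γ₀ t : ℝ}
    (hγ : ∀ i, γ₀ ≤ γ i) (ht : 0 < t) {τ : ℝ} (hτ : τ ∈ Ioc 0 t) :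
    ‖_root_.deriv (gseries a γ) τ‖ ≤ (∑' i, |a i * γ i| * t ^ (γ i - γ₀)) * τ ^ (γ₀ - 1) := by
  have hs : Summable fun i => |a i * γ i| * t ^ (γ i - γ₀) := by
    refine ((h.mul_exponent.summable t ht).mul_right (t ^ (-γ₀))).congr fun i => ?_
    rw [sub_eq_add_neg, Real.rpow_add ht, mul_assoc]
  rw [h.deriv hτ.1, gseries, ← tsum_mul_left, ← tsum_mul_right]
  refine tsum_of_norm_bounded (hs.mul_right _).hasSum fun i => ?_
  have h2 : 0 ≤ τ ^ γ i := Real.rpow_nonneg hτ.1.le _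
  rw [norm_mul, norm_mul, Real.norm_of_nonneg h2, Real.norm_of_nonneg (inv_nonneg.2 hτ.1.le),
    Real.norm_eq_abs]
  have h3 : τ⁻¹ * τ ^ γ i ≤ t ^ (γ i - γ₀) * τ ^ (γ₀ - 1) := by
    rw [← Real.rpow_neg_one, ← Real.rpow_add hτ.1, show -1 + γ i = (γ i - γ₀) + (γ₀ - 1) by ring,
      Real.rpow_add hτ.1]
    have := Real.rpow_le_rpow hτ.1.le hτ.2 (sub_nonneg.2 (hγ i))
    have := Real.rpow_nonneg hτ.1.le (γ₀ - 1)
    gcongr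
  calc _ = |a i * γ i| * (τ⁻¹ * τ ^ γ i) := by ring
    _ ≤ |a i * γ i| * (t ^ (γ i - γ₀) * τ ^ (γ₀ - 1)) := by gcongr
    _ = _ := by ring

theorem IsEntireSeries.intervalIntegrable_caputo (h : IsEntireSeries a γ) {γ₀ β t : ℝ}
    (hγ₀ : 0 < γ₀) (hγ : ∀ i, γ₀ ≤ γ i) (hβ : β < 1) (ht : 0 < t) :
    IntervalIntegrable (fun τ => (t - τ) ^ (-β) • _root_.deriv (gseries a γ) τ) volume 0 t :=
  intervalIntegrable_sub_rpow_smul hγ₀ hβ ht (stronglyMeasurable_deriv _).aestronglyMeasurable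
    fun _ hτ => h.norm_deriv_le hγ ht ⟨hτ.1, hτ.2.le⟩

theorem IsEntireSeries.caputoDeriv_eq [Countable ι] (h : IsEntireSeries a γ) {γ₀ β t : ℝ}
    (hγ₀ : 0 < γ₀) (hγ : ∀ i, γ₀ ≤ γ i) (hβ : β < 1) (ht : 0 < t) :
    caputoDeriv β (gseries a γ) t
      = gseries (fun i => a i * caputoFactor β (γ i)) (fun i => γ i - β) t := by
  have hΓ : Real.Gamma (1 - β) ≠ 0 := (Real.Gamma_pos_of_pos (by linarith)).ne'
  have := (hasSum_caputo h hγ₀ hγ hβ ht).tsum_eq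
  simp only [caputoDeriv, smul_eq_mul]
  rw [← this, gseries, ← tsum_mul_left]
  refine tsum_congr fun i => ?_
  field_simp

theorem IsEntireSeries.caputo [Countable ι] (h : IsEntireSeries a γ) {γ₀ β : ℝ}
    (hγ₀ : 0 < γ₀) (hγ : ∀ i, γ₀ ≤ γ i) (hβ : β < 1) (hβγ : β ≤ γ₀) :
    IsEntireSeries (fun i => a i * caputoFactor β (γ i)) (fun i => γ i - β) := by
  refine ⟨fun i => by linarith [hγ i], fun R hR => ?_⟩
  have hΓ : 0 < Real.Gamma (1 - β) := Real.Gamma_pos_of_pos (by linarith)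
  have h' : IsEntireSeries (fun i => |a i|) γ := ⟨h.nonneg, fun R hR => by
    simpa using h.summable R hR⟩
  refine ((hasSum_caputo h' hγ₀ hγ hβ hR).summable.mul_left (Real.Gamma (1 - β))⁻¹).congr
    fun i => ?_
  rw [abs_mul, abs_of_nonneg (caputoFactor_nonneg (hγ₀.le.trans (hγ i)) hβ)]
  field_simp

/-- The commutator of `t d/dt` with `∂^β`: the Euler operator multiplies `t^γ` by `γ` before the
Caputo derivative and by `γ - β` after it. -/
theorem IsEntireSeries.mul_deriv_caputoDeriv [Countable ι] (h : IsEntireSeries a γ) {γ₀ β t : ℝ}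
    (hγ₀ : 0 < γ₀) (hγ : ∀ i, γ₀ ≤ γ i) (hβ : β < 1) (hβγ : β ≤ γ₀) (ht : 0 < t) :
    HasDerivAt (caputoDeriv β (gseries a γ))
      (t⁻¹ * (caputoDeriv β (gseries (fun i => a i * γ i) γ) t
        - β * caputoDeriv β (gseries a γ) t)) t := by
  have hc := h.caputo hγ₀ hγ hβ hβγ
  have h1 := hc.hasDerivAt ht
  have h2 : caputoDeriv β (gseries a γ)
      =ᶠ[𝓝 t] gseries (fun i => a i * caputoFactor β (γ i)) (fun i => γ i - β) := by
    filter_upwards [lt_mem_nhds ht] with s hs using h.caputoDeriv_eq hγ₀ hγ hβ hs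
  refine (h1.congr_of_eventuallyEq h2).congr_deriv ?_
  have hc' := h.mul_exponent.caputo hγ₀ hγ hβ hβγ
  rw [h.caputoDeriv_eq hγ₀ hγ hβ ht, h.mul_exponent.caputoDeriv_eq hγ₀ hγ hβ ht]
  congr 1
  simp only [gseries]
  rw [← tsum_mul_left, ← (hc'.summable_apply ht).tsum_sub ((hc.summable_apply ht).mul_left β)]
  refine tsum_congr fun i => ?_
  ring

end Series

/-! ### The multinomial Mittag-Leffler series -/

/-- Keep only the part `s > r` of the Gamma integral, where `s^x ≥ r^x`. As `r` is free, the
reciprocal Gamma function beats every geometric growth. -/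
theorem inv_Gamma_one_add_le {x r : ℝ} (hx : 0 ≤ x) (hr : 0 < r) :
    (Real.Gamma (1 + x))⁻¹ ≤ Real.exp r * r ^ (-x) := by
  have h1 : r ^ x * Real.exp (-r) ≤ Real.Gamma (1 + x) := by
    rw [Real.Gamma_eq_integral (by linarith)]
    have hint := Real.GammaIntegral_convergent (s := 1 + x) (by linarith)
    calc r ^ x * Real.exp (-r) = ∫ s in Ioi r, r ^ x * Real.exp (-s) := by
          rw [integral_const_mul, integral_exp_neg_Ioi]
      _ ≤ ∫ s in Ioi r, Real.exp (-s) * s ^ (1 + x - 1) := by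
          refine setIntegral_mono_on ?_ (hint.mono_set (Ioi_subset_Ioi hr.le)) measurableSet_Ioi ?_
          · exact (integrableOn_exp_neg_Ioi r).const_mul _
          · intro s hs
            have := Real.rpow_le_rpow hr.le (le_of_lt hs) hx
            rw [show 1 + x - 1 = x by ring, mul_comm]
            gcongr
      _ ≤ _ := by
          refine setIntegral_mono_set hint ?_ (Ioi_subset_Ioi hr.le).eventuallyLE
          refine (ae_restrict_mem measurableSet_Ioi).mono fun s hs => ?_
          have := Real.rpow_nonneg (le_of_lt hs) (1 + x - 1)
          simp only [Pi.zero_apply]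
          positivity
  have h2 : 0 < r ^ x * Real.exp (-r) := by positivity
  calc (Real.Gamma (1 + x))⁻¹ ≤ (r ^ x * Real.exp (-r))⁻¹ := inv_anti₀ h2 h1
    _ = _ := by rw [mul_inv, Real.rpow_neg hr.le, Real.exp_neg, inv_inv, mul_comm]

/-- The recurrence for multinomial sums, a reformulation of `(∑ zᵢ Xᵢ)^(k+1) = ∑ᵢ zᵢ Xᵢ (∑ zᵢ Xᵢ)^k`. -/
theorem sum_piAntidiag_succ {n : ℕ} (z : Fin n → ℝ) (w : (Fin n → ℕ) → ℝ) (k : ℕ) :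
    ∑ l ∈ Finset.piAntidiag (Finset.univ : Finset (Fin n)) (k + 1),
        (Nat.multinomial Finset.univ l : ℝ) * (∏ i, z i ^ l i) * w l
      = ∑ i, z i * ∑ l ∈ Finset.piAntidiag (Finset.univ : Finset (Fin n)) k,
        (Nat.multinomial Finset.univ l : ℝ) * (∏ i, z i ^ l i) * w (l + Pi.single i 1) := by
  classical
  let S : MvPolynomial (Fin n) ℝ := ∑ i, MvPolynomial.C (z i) * MvPolynomial.X i
  -- The arbitrary weights become a linear functional on polynomials, so the claim is `Λ` applied to
  -- `S^(k+1) = S^k * S`.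
  let Λ : MvPolynomial (Fin n) ℝ →ₗ[ℝ] ℝ :=
    (MvPolynomial.basisMonomials (Fin n) ℝ).constr ℝ fun l => w l
  have hΛ : ∀ (l : Fin n →₀ ℕ) (c : ℝ), Λ (MvPolynomial.monomial l c) = c * w l := by
    intro l c
    have : MvPolynomial.monomial l c = c • (MvPolynomial.basisMonomials (Fin n) ℝ) l := by
      simp [MvPolynomial.smul_monomial]
    rw [this, map_smul, Module.Basis.constr_basis, smul_eq_mul]
  have hS : ∀ k : ℕ, S ^ k = ∑ l ∈ Finset.piAntidiag (Finset.univ : Finset (Fin n)) k,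
      MvPolynomial.monomial (Finsupp.equivFunOnFinite.symm l)
        ((Nat.multinomial Finset.univ l : ℝ) * ∏ i, z i ^ l i) := by
    intro k
    rw [Finset.sum_pow_eq_sum_piAntidiag]
    refine Finset.sum_congr rfl fun l _ => ?_
    rw [MvPolynomial.monomial_eq, Finsupp.prod_fintype _ _ (by simp)]
    simp [mul_pow, Finset.prod_mul_distrib, mul_assoc]
  have h1 : Λ (S ^ (k + 1)) = ∑ i, z i * Λ (S ^ k * MvPolynomial.X i) := by
    rw [pow_succ, Finset.mul_sum, map_sum]
    refine Finset.sum_congr rfl fun i _ => ?_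
    rw [mul_left_comm, ← MvPolynomial.smul_eq_C_mul, map_smul, smul_eq_mul]
  have h2 : ∀ i, S ^ k * MvPolynomial.X i =
      ∑ l ∈ Finset.piAntidiag (Finset.univ : Finset (Fin n)) k,
      MvPolynomial.monomial (Finsupp.equivFunOnFinite.symm l + Finsupp.single i 1)
        ((Nat.multinomial Finset.univ l : ℝ) * ∏ i, z i ^ l i) := by
    intro i
    rw [hS, Finset.sum_mul]
    refine Finset.sum_congr rfl fun l _ => ?_
    rw [MvPolynomial.X, MvPolynomial.monomial_mul, mul_one]
  rw [hS] at h1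
  have h3 : ∀ (l : Fin n → ℕ) (i : Fin n),
      ⇑(Finsupp.equivFunOnFinite.symm l + Finsupp.single i 1 : Fin n →₀ ℕ) = l + Pi.single i 1 := by
    intro l i
    funext j
    simp [Finsupp.single_apply, Pi.single_apply, eq_comm]
  simpa only [h2, map_sum, hΛ, h3, Finsupp.coe_equivFunOnFinite_symm] using h1

/-- Multi-indices in `ℕⁿ`, grouped by their length. -/
abbrev MLIndex (n : ℕ) : Type :=
  Σ k : ℕ, ↥(Finset.piAntidiag (Finset.univ : Finset (Fin n)) k)

section MittagLeffler

variable {n : ℕ}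

/-- The coefficient `k!/(l₁!⋯lₙ!) ∏ zᵢ^{lᵢ}`. -/
noncomputable def mlCoeff (z : Fin n → ℝ) (i : MLIndex n) : ℝ :=
  (Nat.multinomial Finset.univ i.2.1 : ℝ) * ∏ j, z j ^ i.2.1 j

/-- The exponent `μ + ∑ βᵢ lᵢ`. -/
noncomputable def mlExp (β : Fin n → ℝ) (μ : ℝ) (i : MLIndex n) : ℝ := μ + ∑ j, β j * i.2.1 j

/-- The generalized power series `∑ₗ k!/(l₁!⋯lₙ!) ∏ zᵢ^{lᵢ} t^{μ+β·l}/Γ(1+μ+β·l)`. -/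
noncomputable def mlSeries (β z : Fin n → ℝ) (μ : ℝ) : ℝ → ℝ :=
  gseries (fun i => mlCoeff z i / Real.Gamma (1 + mlExp β μ i)) (mlExp β μ)

theorem le_mlExp {β : Fin n → ℝ} (hβ : ∀ i, 0 < β i) (μ : ℝ) (i : MLIndex n) :
    μ ≤ mlExp β μ i := by
  have : 0 ≤ ∑ j, β j * i.2.1 j := Finset.sum_nonneg fun j _ =>
    mul_nonneg (hβ j).le (Nat.cast_nonneg _)
  unfold mlExp
  linarith

/-- For small `x` one has `∑ |zⱼ| x^{βⱼ} < 1`, and by the multinomial theorem the terms of length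
`k` add up to the `k`-th power of this number, times `x^μ`. -/
theorem summable_abs_mlCoeff_mul_rpow {β : Fin n → ℝ} (hβ : ∀ i, 0 < β i) (z : Fin n → ℝ) :
    ∃ x : ℝ, 0 < x ∧ ∀ μ, Summable fun i : MLIndex n => |mlCoeff z i| * x ^ mlExp β μ i := by
  have hcont : Tendsto (fun x : ℝ => ∑ j, |z j| * x ^ β j) (𝓝[>] 0) (𝓝 0) := by
    have : Tendsto (fun x : ℝ => ∑ j, |z j| * x ^ β j) (𝓝 0) (𝓝 (∑ j, |z j| * (0 : ℝ) ^ β j)) :=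
      tendsto_finsetSum _ fun j _ =>
        ((Real.continuousAt_rpow_const 0 (β j) (Or.inr (hβ j).le)).tendsto).const_mul _
    simp only [Real.zero_rpow (hβ _).ne', mul_zero, Finset.sum_const_zero] at this
    exact this.mono_left nhdsWithin_le_nhds
  obtain ⟨x, hx, hx0⟩ := ((hcont.eventually (gt_mem_nhds (show (0 : ℝ) < 1 by norm_num))).and
    self_mem_nhdsWithin).exists
  have hx0 : 0 < x := hx0
  refine ⟨x, hx0, fun μ => ?_⟩
  have hk : ∀ k : ℕ, ∑ l : ↥(Finset.piAntidiag (Finset.univ : Finset (Fin n)) k),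
      |mlCoeff z ⟨k, l⟩| * x ^ mlExp β μ ⟨k, l⟩ = (∑ j, |z j| * x ^ β j) ^ k * x ^ μ := by
    intro k
    rw [Finset.sum_pow_eq_sum_piAntidiag, Finset.sum_mul, ← Finset.sum_coe_sort (Finset.piAntidiag _ k)]
    refine Finset.sum_congr rfl fun l _ => ?_
    rw [mlCoeff, mlExp, abs_mul, Finset.abs_prod, Nat.abs_cast, Real.rpow_add hx0,
      Real.rpow_sum_of_pos hx0]
    simp only [mul_pow, Finset.prod_mul_distrib, abs_pow, Real.rpow_mul_natCast hx0.le]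
    ring
  rw [summable_sigma_of_nonneg fun i => by positivity]
  refine ⟨fun k => (hasSum_fintype _).summable, ?_⟩
  simp only [tsum_fintype, hk]
  exact (summable_geometric_of_lt_one (Finset.sum_nonneg fun j _ => by positivity) hx).mul_right _

theorem isEntireSeries_mlSeries {β : Fin n → ℝ} (hβ : ∀ i, 0 < β i) (z : Fin n → ℝ) {μ : ℝ}
    (hμ : 0 ≤ μ) :
    IsEntireSeries (fun i => mlCoeff z i / Real.Gamma (1 + mlExp β μ i)) (mlExp β μ) := by
  refine ⟨fun i => hμ.trans (le_mlExp hβ μ i), fun R hR => ?_⟩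
  obtain ⟨x, hx, hs⟩ := summable_abs_mlCoeff_mul_rpow hβ z
  refine Summable.of_nonneg_of_le (fun i => by positivity) (fun i => ?_)
    ((hs μ).mul_left (Real.exp (R / x)))
  have h0 : 0 ≤ mlExp β μ i := hμ.trans (le_mlExp hβ μ i)
  -- The choice `r = R/x` turns `R^γ/Γ(1+γ)` into at most `exp(R/x) x^γ`, which is summable against
  -- the coefficients.
  have h1 := inv_Gamma_one_add_le h0 (r := R / x) (by positivity)
  have hΓ : 0 < Real.Gamma (1 + mlExp β μ i) := Real.Gamma_pos_of_pos (by linarith)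
  rw [abs_div, abs_of_pos hΓ, div_eq_mul_inv]
  calc |mlCoeff z i| * (Real.Gamma (1 + mlExp β μ i))⁻¹ * R ^ mlExp β μ i
      ≤ |mlCoeff z i| * (Real.exp (R / x) * (R / x) ^ (-mlExp β μ i)) * R ^ mlExp β μ i := by
        gcongr
    _ = _ := by
        rw [Real.rpow_neg (by positivity), Real.div_rpow hR.le hx.le]
        have := Real.rpow_pos_of_pos hR (mlExp β μ i)
        field_simp

theorem mlSeries_eq_tsum {β : Fin n → ℝ} (hβ : ∀ i, 0 < β i) (z : Fin n → ℝ) {μ : ℝ}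
    (hμ : 0 ≤ μ) {t : ℝ} (ht : 0 < t) :
    HasSum (fun k : ℕ => ∑ l ∈ Finset.piAntidiag (Finset.univ : Finset (Fin n)) k,
      (Nat.multinomial Finset.univ l : ℝ) * (∏ i, z i ^ l i) *
        (t ^ (μ + ∑ i, β i * l i) / Real.Gamma (1 + (μ + ∑ i, β i * l i))))
      (mlSeries β z μ t) := by
  have h := ((isEntireSeries_mlSeries hβ z hμ).summable_apply ht).hasSum.sigma
    (fun k => hasSum_fintype _)
  refine HasSum.congr_fun h fun k => ?_
  rw [← Finset.sum_coe_sort (Finset.piAntidiag _ k)]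
  refine Finset.sum_congr rfl fun l _ => ?_
  simp only [mlCoeff, mlExp]
  ring

/-- Split off `k = 0` and apply the multinomial recurrence to the rest: raising `lᵢ` by one raises
the exponent by `βᵢ`. This identity is the differential equation in disguise. -/
theorem mlSeries_zero {β : Fin n → ℝ} (hβ : ∀ i, 0 < β i) (z : Fin n → ℝ) {t : ℝ} (ht : 0 < t) :
    mlSeries β z 0 t = 1 + ∑ i, z i * mlSeries β z (β i) t := by
  have h0 := mlSeries_eq_tsum hβ z le_rfl ht
  rw [← h0.tsum_eq, h0.summable.tsum_eq_zero_add]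
  congr 1
  · simp [Nat.multinomial]
  · have h1 := hasSum_sum (s := Finset.univ)
      fun i _ => (mlSeries_eq_tsum hβ z (hβ i).le ht).mul_left (z i)
    rw [← h1.tsum_eq]
    refine tsum_congr fun k => ?_
    have := sum_piAntidiag_succ z
      (fun l => t ^ (0 + ∑ i, β i * (l i : ℝ)) / Real.Gamma (1 + (0 + ∑ i, β i * (l i : ℝ)))) k
    rw [this]
    refine Finset.sum_congr rfl fun i _ => ?_
    congr 1
    refine Finset.sum_congr rfl fun l _ => ?_
    have e : (0 + ∑ j, β j * (((l + Pi.single i 1 : Fin n → ℕ) j : ℕ) : ℝ))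
        = β i + ∑ j, β j * (l j : ℝ) := by
      simp [mul_add, Finset.sum_add_distrib, Pi.single_apply, add_comm]
    rw [e]

/-- The denominator `Γ(1+γ)` is the numerator of the Caputo factor of `t^γ`, so differentiation only
lowers `μ`. -/
theorem caputoDeriv_mlSeries {β : Fin n → ℝ} (hβ : ∀ i, 0 < β i) (z : Fin n → ℝ) {μ ν : ℝ}
    (hμ : 0 < μ) (hν : ν < 1) {t : ℝ} (ht : 0 < t) :
    caputoDeriv ν (mlSeries β z μ) t = mlSeries β z (μ - ν) t := by
  rw [mlSeries, (isEntireSeries_mlSeries hβ z hμ.le).caputoDeriv_eq hμ (le_mlExp hβ μ) hν ht,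
    mlSeries, gseries, gseries]
  refine tsum_congr fun i => ?_
  have e : mlExp β (μ - ν) i = mlExp β μ i - ν := by unfold mlExp; ring
  have h0 := le_mlExp hβ μ i
  have hΓ : 0 < Real.Gamma (1 + mlExp β μ i) := Real.Gamma_pos_of_pos (by linarith)
  rw [e, caputoFactor, add_comm _ 1]
  rw [show 1 + (mlExp β μ i - ν) = 1 + mlExp β μ i - ν by ring]
  field_simp

theorem mul_multinomialML {β : Fin n → ℝ} (hβ : ∀ i, 0 < β i) (z : Fin n → ℝ) {μ : ℝ} (hμ : 0 ≤ μ)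
    {t : ℝ} (ht : 0 < t) :
    t ^ μ * multinomialML β (1 + μ) (fun i => z i * t ^ β i) = mlSeries β z μ t := by
  rw [← (mlSeries_eq_tsum hβ z hμ ht).tsum_eq, multinomialML, ← tsum_mul_left]
  refine tsum_congr fun k => ?_
  rw [Finset.mul_sum]
  refine Finset.sum_congr rfl fun l _ => ?_
  rw [Real.rpow_add ht, Real.rpow_sum_of_pos ht]
  simp only [mul_pow, Finset.prod_mul_distrib, Real.rpow_mul_natCast ht.le, add_assoc]
  ring

end MittagLeffler

/-! ### The extremum principle for Caputo derivatives -/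

/-- If `f` attains its maximum over `[0, t]` at `t`, its Caputo derivative at `t` is nonnegative. -/
theorem caputoDeriv_nonneg_of_max {f : ℝ → ℝ} {β t : ℝ} (hβ₀ : 0 < β) (hβ₁ : β < 1) (ht : 0 < t)
    (hc : ContinuousOn f (Icc 0 t)) (hd : ∀ τ, 0 < τ → DifferentiableAt ℝ f τ)
    (hi : IntervalIntegrable (fun τ => (t - τ) ^ (-β) • deriv f τ) volume 0 t)
    (hmax : ∀ τ ∈ Icc 0 t, f τ ≤ f t) : 0 ≤ caputoDeriv β f t := by
  have hΓ : 0 < Real.Gamma (1 - β) := Real.Gamma_pos_of_pos (by linarith)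
  refine smul_nonneg (inv_nonneg.2 hΓ.le) ?_
  -- An integration by parts in the form of an inequality: `g' ≤ (t-τ)^(-β) f'` because `f τ ≤ f t`,
  -- while `g t = 0` and `g 0 ≤ 0`. Differentiability of `f` at `t` gives `g = O((t-τ)^(1-β))`,
  -- hence continuity at the singular endpoint.
  set g : ℝ → ℝ := fun τ => (t - τ) ^ (-β) * (f τ - f t) with hg
  have hgc : ContinuousOn g (Icc 0 t) := by
    intro τ hτ
    rcases hτ.2.lt_or_eq with h | rfl
    · refine ContinuousWithinAt.mul ?_ ((hc τ hτ).sub continuousWithinAt_const)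
      refine ContinuousWithinAt.rpow_const (by fun_prop) (Or.inl ?_)
      linarith
    · have hO : (fun s => f s - f τ) =O[𝓝[Icc 0 τ] τ] fun s => τ - s := by
        have := ((hd τ ht).isBigO_sub).mono (nhdsWithin_le_nhds (s := Icc 0 τ))
        refine this.trans (Asymptotics.isBigO_of_le _ fun s => ?_)
        rw [norm_sub_rev]
      have hO2 : g =O[𝓝[Icc 0 τ] τ] fun s => (τ - s) ^ (1 - β) := by
        refine ((Asymptotics.isBigO_refl (fun s : ℝ => (τ - s) ^ (-β)) _).mul hO).congr'
          EventuallyEq.rfl ?_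
        filter_upwards [self_mem_nhdsWithin] with s hs
        rcases hs.2.lt_or_eq with h | rfl
        · rw [sub_eq_add_neg 1 β, add_comm, Real.rpow_add_one (by linarith)]
        · simp [Real.zero_rpow (show 1 - β ≠ 0 by linarith)]
      have hT : Tendsto (fun s : ℝ => (τ - s) ^ (1 - β)) (𝓝[Icc 0 τ] τ) (𝓝 0) := by
        have hcc : ContinuousAt (fun s : ℝ => (τ - s) ^ (1 - β)) τ :=
          ContinuousAt.rpow_const (by fun_prop) (Or.inr (by linarith))
        have h0 : (τ - τ) ^ (1 - β) = 0 := by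
          rw [sub_self, Real.zero_rpow (by linarith)]
        have := hcc.tendsto.mono_left (nhdsWithin_le_nhds (s := Icc 0 τ))
        rwa [h0] at this
      have h0 : g τ = 0 := by simp [hg]
      rw [ContinuousWithinAt, h0]
      exact hO2.trans_tendsto hT
  have hgd : ∀ τ ∈ Ioo 0 t, HasDerivWithinAt g
      ((-1) * (-β) * (t - τ) ^ (-β - 1) * (f τ - f t) + (t - τ) ^ (-β) * deriv f τ) (Ioi τ) τ := by
    intro τ hτ
    have h1 : HasDerivAt (fun s : ℝ => t - s) (-1) τ := (hasDerivAt_id τ).const_sub t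
    exact ((h1.rpow_const (p := -β) (Or.inl (by linarith [hτ.2]))).mul
      ((hd τ hτ.1).hasDerivAt.sub_const _)).hasDerivWithinAt
  have := intervalIntegral.sub_le_integral_of_hasDeriv_right_of_le ht.le hgc hgd
    (φ := fun τ => (t - τ) ^ (-β) • deriv f τ) ?_ ?_
  · refine le_trans ?_ this
    have h1 : g t = 0 := by simp [hg]
    have h2 : g 0 ≤ 0 := by
      refine mul_nonpos_of_nonneg_of_nonpos (Real.rpow_nonneg (by linarith) _) ?_
      linarith [hmax 0 ⟨le_rfl, ht.le⟩]
    linarith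
  · rwa [integrableOn_Icc_iff_integrableOn_Ioc, ← intervalIntegrable_iff_integrableOn_Ioc_of_le ht.le]
  · intro τ hτ
    have h1 : (-1) * (-β) * (t - τ) ^ (-β - 1) * (f τ - f t) ≤ 0 := by
      refine mul_nonpos_of_nonneg_of_nonpos ?_ (by linarith [hmax τ ⟨hτ.1.le, hτ.2.le⟩])
      have := Real.rpow_nonneg (show 0 ≤ t - τ by linarith [hτ.2]) (-β - 1)
      rw [neg_one_mul, neg_neg]
      positivity
    simp only [smul_eq_mul]
    linarith

/-- Functions on `[0, ∞)` which are continuous, differentiable off `0`, and have Caputo derivatives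
of all orders below `1`. -/
structure CaputoRegular (f : ℝ → ℝ) : Prop where
  continuousOn : ContinuousOn f (Ici 0)
  differentiableAt : ∀ t : ℝ, 0 < t → DifferentiableAt ℝ f t
  intervalIntegrable : ∀ β : ℝ, β < 1 → ∀ t : ℝ, 0 < t →
    IntervalIntegrable (fun τ => (t - τ) ^ (-β) • deriv f τ) volume 0 t

theorem CaputoRegular.add {f g : ℝ → ℝ} (hf : CaputoRegular f) (hg : CaputoRegular g) :
    CaputoRegular (fun t => f t + g t) := by
  refine ⟨hf.continuousOn.add hg.continuousOn,
    fun t ht => (hf.differentiableAt t ht).add (hg.differentiableAt t ht), fun β hβ t ht => ?_⟩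
  refine ((hf.intervalIntegrable β hβ t ht).add (hg.intervalIntegrable β hβ t ht)).congr ?_
  intro τ hτ
  rw [uIoc_of_le ht.le] at hτ
  simp only [smul_eq_mul]
  rw [deriv_fun_add (hf.differentiableAt τ hτ.1) (hg.differentiableAt τ hτ.1)]
  ring

theorem CaputoRegular.const_mul {f : ℝ → ℝ} (c : ℝ) (hf : CaputoRegular f) :
    CaputoRegular (fun t => c * f t) := by
  refine ⟨continuousOn_const.mul hf.continuousOn,
    fun t ht => (hf.differentiableAt t ht).const_mul c, fun β hβ t ht => ?_⟩
  refine ((hf.intervalIntegrable β hβ t ht).const_mul c).congr ?_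
  intro τ hτ
  rw [uIoc_of_le ht.le] at hτ
  simp only [smul_eq_mul]
  rw [deriv_const_mul _ (hf.differentiableAt τ hτ.1)]
  ring

theorem caputoRegular_const (c : ℝ) : CaputoRegular (fun _ => c) :=
  ⟨continuousOn_const, fun _ _ => differentiableAt_const c, fun β _ t _ => by simp⟩

theorem caputoDeriv_const (β c t : ℝ) : caputoDeriv β (fun _ : ℝ => c) t = 0 := by
  simp [caputoDeriv]

theorem CaputoRegular.caputoDeriv_add {f g : ℝ → ℝ} (hf : CaputoRegular f) (hg : CaputoRegular g)
    {β t : ℝ} (hβ : β < 1) (ht : 0 < t) :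
    caputoDeriv β (fun t => f t + g t) t = caputoDeriv β f t + caputoDeriv β g t := by
  rw [caputoDeriv, caputoDeriv, caputoDeriv, ← smul_add, ← intervalIntegral.integral_add
    (hf.intervalIntegrable β hβ t ht) (hg.intervalIntegrable β hβ t ht)]
  congr 1
  refine intervalIntegral.integral_congr_ae (ae_of_all _ fun τ hτ => ?_)
  rw [uIoc_of_le ht.le] at hτ
  rw [deriv_fun_add (hf.differentiableAt τ hτ.1) (hg.differentiableAt τ hτ.1), smul_add]

theorem CaputoRegular.caputoDeriv_const_mul {f : ℝ → ℝ} (c : ℝ) (hf : CaputoRegular f)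
    {β t : ℝ} (ht : 0 < t) :
    caputoDeriv β (fun t => c * f t) t = c * caputoDeriv β f t := by
  rw [caputoDeriv, caputoDeriv, smul_eq_mul, smul_eq_mul, mul_left_comm,
    ← intervalIntegral.integral_const_mul c]
  congr 1
  refine intervalIntegral.integral_congr_ae (ae_of_all _ fun τ hτ => ?_)
  rw [uIoc_of_le ht.le] at hτ
  rw [deriv_const_mul _ (hf.differentiableAt τ hτ.1), smul_eq_mul, smul_eq_mul, mul_left_comm]

theorem IsEntireSeries.caputoRegular {ι : Type*} {a γ : ι → ℝ} (h : IsEntireSeries a γ) {γ₀ : ℝ}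
    (hγ₀ : 0 < γ₀) (hγ : ∀ i, γ₀ ≤ γ i) : CaputoRegular (gseries a γ) := by
  refine ⟨fun t ht => ?_, fun t ht => (h.hasDerivAt ht).differentiableAt,
    fun β hβ t ht => h.intervalIntegrable_caputo hγ₀ hγ hβ ht⟩
  have ht : 0 ≤ t := ht
  refine ((h.continuousOn (R := t + 1) (by linarith)) t ⟨ht, by linarith⟩).mono_of_mem_nhdsWithin ?_
  rw [← Ici_inter_Iic]
  exact inter_mem self_mem_nhdsWithin (mem_nhdsWithin_of_mem_nhds (Iic_mem_nhds (by linarith)))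

/-! ### The operator `P(∂ₜ)` and its maximum principle. -/

section MaximumPrinciple

variable {m : ℕ} {α : ℝ} {αs b : Fin m → ℝ}

theorem CaputoRegular.multiTermDeriv_add {f g : ℝ → ℝ} (hf : CaputoRegular f)
    (hg : CaputoRegular g) (hα₁ : α < 1) (hαs : ∀ i, 0 < αs i ∧ αs i < α) {t : ℝ} (ht : 0 < t) :
    multiTermDeriv α αs b (fun t => f t + g t) t
      = multiTermDeriv α αs b f t + multiTermDeriv α αs b g t := by
  have : ∀ i, caputoDeriv (αs i) (fun t => f t + g t) t
      = caputoDeriv (αs i) f t + caputoDeriv (αs i) g t := fun i =>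
    hf.caputoDeriv_add hg ((hαs i).2.trans hα₁) ht
  simp only [multiTermDeriv, hf.caputoDeriv_add hg hα₁ ht, this, smul_add, Finset.sum_add_distrib]
  ring

theorem CaputoRegular.multiTermDeriv_const_mul {f : ℝ → ℝ} (c : ℝ) (hf : CaputoRegular f)
    {t : ℝ} (ht : 0 < t) :
    multiTermDeriv α αs b (fun t => c * f t) t = c * multiTermDeriv α αs b f t := by
  simp only [multiTermDeriv, hf.caputoDeriv_const_mul c ht, smul_eq_mul, mul_add, Finset.mul_sum]
  congr 1
  exact Finset.sum_congr rfl fun i _ => by ring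

theorem multiTermDeriv_const (c t : ℝ) : multiTermDeriv α αs b (fun _ : ℝ => c) t = 0 := by
  simp [multiTermDeriv, caputoDeriv_const]

theorem CaputoRegular.multiTermDeriv_nonneg_of_max {f : ℝ → ℝ} (hf : CaputoRegular f)
    (hα₀ : 0 < α) (hα₁ : α < 1) (hαs : ∀ i, 0 < αs i ∧ αs i < α) (hb : ∀ i, 0 < b i)
    {t : ℝ} (ht : 0 < t) (hmax : ∀ τ ∈ Icc 0 t, f τ ≤ f t) : 0 ≤ multiTermDeriv α αs b f t := by
  have key : ∀ β, 0 < β → β < 1 → 0 ≤ caputoDeriv β f t := fun β h0 h1 =>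
    caputoDeriv_nonneg_of_max h0 h1 ht (hf.continuousOn.mono Icc_subset_Ici_self)
      hf.differentiableAt (hf.intervalIntegrable β h1 t ht) hmax
  exact add_nonneg (key α hα₀ hα₁) (Finset.sum_nonneg fun i _ =>
    smul_nonneg (hb i).le (key _ (hαs i).1 ((hαs i).2.trans hα₁)))

/-- The maximum principle for `P(∂ₜ) + λ`. -/
theorem CaputoRegular.nonneg_of_multiTermDeriv {f : ℝ → ℝ} (hf : CaputoRegular f)
    (hα₀ : 0 < α) (hα₁ : α < 1) (hαs : ∀ i, 0 < αs i ∧ αs i < α) (hb : ∀ i, 0 < b i)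
    {lam : ℝ} (hlam : 0 < lam) (h0 : 0 ≤ f 0)
    (h : ∀ t, 0 < t → 0 ≤ multiTermDeriv α αs b f t + lam * f t) {t : ℝ} (ht : 0 ≤ t) :
    0 ≤ f t := by
  obtain ⟨s, hs, hmin⟩ := isCompact_Icc.exists_isMinOn (nonempty_Icc.2 ht)
    (hf.continuousOn.mono (show Icc 0 t ⊆ Ici 0 from Icc_subset_Ici_self))
  have hmin' : ∀ τ ∈ Icc 0 t, f s ≤ f τ := fun τ hτ => hmin hτ
  refine le_trans ?_ (hmin' t ⟨ht, le_rfl⟩)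
  rcases hs.1.eq_or_lt with rfl | hs0
  · exact h0
  by_contra! hneg
  -- At a negative minimum reached at `s > 0`, `-f` has a maximum over `[0, s]`, so `P(∂ₜ)f ≤ 0`;
  -- together with `λ f < 0` this contradicts the hypothesis.
  have h1 := (hf.const_mul (-1)).multiTermDeriv_nonneg_of_max hα₀ hα₁ hαs hb hs0
    fun τ hτ => by linarith [hmin' τ ⟨hτ.1, hτ.2.trans hs.2⟩]
  rw [hf.multiTermDeriv_const_mul (-1) hs0] at h1
  have h2 := h s hs0
  have h3 : lam * f s < 0 := mul_neg_of_pos_of_neg hlam hneg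
  linarith

end MaximumPrinciple

/-! ### Bounds for the solution of the scalar equation -/

/-- The function `1 + ∑ aᵢ t^{γᵢ}` solves `P(∂ₜ)y + λ y = 0`, and decreases for small `t`. -/
structure IsModeSeries {m : ℕ} {ι : Type*} (α : ℝ) (αs b : Fin m → ℝ) (lam : ℝ) (a γ : ι → ℝ) :
    Prop where
  alpha_pos : 0 < α
  alpha_lt : α < 1
  alphas : ∀ i, 0 < αs i ∧ αs i < α
  b_pos : ∀ i, 0 < b i
  lam_pos : 0 < lam
  entire : IsEntireSeries a γ
  le_exponent : ∀ i, α ≤ γ i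
  equation : ∀ t, 0 < t → multiTermDeriv α αs b (gseries a γ) t = -(lam * (1 + gseries a γ t))
  neg_near_zero : ∃ ε : ℝ, 0 < ε ∧ ∀ t ∈ Ioo 0 ε, gseries (fun i => a i * γ i) γ t < 0

/-- The leading term gives exactly `Γ(α+1)` and the lower orders are nonnegative. This makes `t^α` a
barrier. -/
theorem multiTermDeriv_rpow_ge {m : ℕ} {α : ℝ} {αs b : Fin m → ℝ} (hα₀ : 0 < α) (hα₁ : α < 1)
    (hαs : ∀ i, 0 < αs i ∧ αs i < α) (hb : ∀ i, 0 < b i) {t : ℝ} (ht : 0 < t) :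
    Real.Gamma (α + 1) ≤ multiTermDeriv α αs b (fun t : ℝ => t ^ α) t := by
  have key : ∀ β : ℝ, β < 1 → caputoDeriv β (fun t : ℝ => t ^ α) t
      = caputoFactor β α * t ^ (α - β) := by
    intro β hβ
    have hΓ : Real.Gamma (1 - β) ≠ 0 := (Real.Gamma_pos_of_pos (by linarith)).ne'
    have h1 : ∫ τ in (0 : ℝ)..t, (t - τ) ^ (-β) • deriv (fun t : ℝ => t ^ α) τ
        = ∫ τ in (0 : ℝ)..t, (t - τ) ^ (-β) * (α * τ ^ (α - 1)) := by
      refine intervalIntegral.integral_congr_ae (ae_of_all _ fun τ hτ => ?_)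
      rw [uIoc_of_le ht.le] at hτ
      rw [Real.deriv_rpow_const, smul_eq_mul]
    rw [caputoDeriv, h1, integral_sub_rpow_mul_deriv_rpow hα₀ hβ ht, smul_eq_mul]
    field_simp
  rw [multiTermDeriv, key α hα₁]
  have h0 : caputoFactor α α * t ^ (α - α) = Real.Gamma (α + 1) := by
    rw [sub_self, Real.rpow_zero, caputoFactor, add_sub_cancel_left, Real.Gamma_one]
    simp
  rw [h0]
  refine le_add_of_nonneg_right (Finset.sum_nonneg fun i _ => ?_)
  rw [key _ ((hαs i).2.trans hα₁)]
  exact smul_nonneg (hb i).le (mul_nonneg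
    (caputoFactor_nonneg hα₀.le ((hαs i).2.trans hα₁)) (Real.rpow_nonneg ht.le _))

theorem caputoRegular_rpow {α : ℝ} (hα : 0 < α) : CaputoRegular (fun t : ℝ => t ^ α) := by
  have h : IsEntireSeries (fun _ : Unit => (1 : ℝ)) (fun _ => α) :=
    ⟨fun _ => hα.le, fun R _ => (hasSum_fintype _).summable⟩
  have := h.caputoRegular hα (fun _ => le_rfl)
  have e : gseries (fun _ : Unit => (1 : ℝ)) (fun _ => α) = fun t => t ^ α := by
    funext t
    simp [gseries]
  rwa [e] at this

namespace IsModeSeries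

variable {m : ℕ} {ι : Type*} {α : ℝ} {αs b : Fin m → ℝ} {lam : ℝ} {a γ : ι → ℝ}

theorem caputoRegular (h : IsModeSeries α αs b lam a γ) : CaputoRegular (gseries a γ) :=
  h.entire.caputoRegular h.alpha_pos h.le_exponent

theorem caputoRegular_euler (h : IsModeSeries α αs b lam a γ) :
    CaputoRegular (gseries (fun i => a i * γ i) γ) :=
  h.entire.mul_exponent.caputoRegular h.alpha_pos h.le_exponent

/-- The equation satisfied by `t y'(t)`. -/
theorem euler_equation [Countable ι] (h : IsModeSeries α αs b lam a γ) {t : ℝ} (ht : 0 < t) :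
    multiTermDeriv α αs b (gseries (fun i => a i * γ i) γ) t
        + lam * gseries (fun i => a i * γ i) γ t
      = α * caputoDeriv α (gseries a γ) t + ∑ i, αs i * (b i * caputoDeriv (αs i) (gseries a γ) t) := by
  have hd : ∀ β, β < 1 → β ≤ α → _ := fun β h1 h2 =>
    h.entire.mul_deriv_caputoDeriv h.alpha_pos h.le_exponent h1 h2 ht
  have h1 := (hd α h.alpha_lt le_rfl).add (HasDerivAt.fun_sum (u := Finset.univ) fun i _ =>
    (hd (αs i) ((h.alphas i).2.trans h.alpha_lt) (h.alphas i).2.le).const_mul (b i))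
  have h2 := ((h.entire.hasDerivAt ht).const_add 1).const_mul lam
  have h3 := h1.add h2
  -- Near `t` the function differentiated in `h3` is `P(∂ₜ)y + λy`, which vanishes; its derivative
  -- is therefore zero.
  have h4 : HasDerivAt (fun _ : ℝ => (0 : ℝ)) _ t := h3.congr_of_eventuallyEq (by
    filter_upwards [lt_mem_nhds ht] with s hs
    have := h.equation s hs
    simp only [multiTermDeriv, smul_eq_mul] at this
    simp only [Pi.add_apply]
    linarith)
  have h5 := h4.unique (hasDerivAt_const t (0 : ℝ))
  simp only [multiTermDeriv, smul_eq_mul]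
  have h6 : ∀ i, b i * (t⁻¹ * (caputoDeriv (αs i) (gseries (fun i => a i * γ i) γ) t
      - αs i * caputoDeriv (αs i) (gseries a γ) t))
      = t⁻¹ * (b i * caputoDeriv (αs i) (gseries (fun i => a i * γ i) γ) t)
        - t⁻¹ * (αs i * (b i * caputoDeriv (αs i) (gseries a γ) t)) := fun i => by ring
  simp only [h6, Finset.sum_sub_distrib, ← Finset.mul_sum] at h5
  have ht' : t ≠ 0 := ht.ne'
  field_simp at h5
  simp only [← mul_assoc]
  linarith

theorem deriv_eq (h : IsModeSeries α αs b lam a γ) {t : ℝ} (ht : 0 < t) :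
    deriv (gseries a γ) t = t⁻¹ * gseries (fun i => a i * γ i) γ t :=
  h.entire.deriv ht

/-- Otherwise take the first point `s` where `G = t y'` is nonnegative. There `G` attains its
maximum over `[0, s]`, so the left side of the Euler equation is nonnegative; but `y' < 0` on `(0,
s)` makes the right side negative. -/
theorem euler_neg [Countable ι] (h : IsModeSeries α αs b lam a γ) {t : ℝ} (ht : 0 < t) :
    gseries (fun i => a i * γ i) γ t < 0 := by
  by_contra! hcon
  set G := gseries (fun i => a i * γ i) γ with hG
  obtain ⟨ε, hε, hneg⟩ := h.neg_near_zero
  have hεt : ε ≤ t := by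
    by_contra! hlt
    exact absurd (hneg t ⟨ht, hlt⟩) (not_lt.2 hcon)
  have hcont : ContinuousOn G (Icc ε t) :=
    h.caputoRegular_euler.continuousOn.mono fun s hs => hε.le.trans hs.1
  have hcomp : IsCompact (Icc ε t ∩ G ⁻¹' Ici 0) :=
    isCompact_Icc.of_isClosed_subset (hcont.preimage_isClosed_of_isClosed isClosed_Icc isClosed_Ici)
      inter_subset_left
  obtain ⟨s, ⟨hs1, hs2⟩, hs3⟩ := hcomp.exists_isLeast ⟨t, ⟨hεt, le_rfl⟩, hcon⟩
  have hs0 : 0 < s := hε.trans_le hs1.1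
  have hlt : ∀ τ ∈ Ioo 0 s, G τ < 0 := by
    intro τ hτ
    rcases lt_or_ge τ ε with h1 | h1
    · exact hneg τ ⟨hτ.1, h1⟩
    · by_contra! h2
      exact absurd (hs3 ⟨⟨h1, hτ.2.le.trans hs1.2⟩, h2⟩) (not_le.2 hτ.2)
  have hs2 : 0 ≤ G s := hs2
  have h0 : G 0 = 0 := gseries_zero fun i => h.alpha_pos.trans_le (h.le_exponent i)
  have hmax := h.caputoRegular_euler.multiTermDeriv_nonneg_of_max h.alpha_pos h.alpha_lt h.alphas
    h.b_pos hs0 (fun τ hτ => by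
      rcases hτ.1.eq_or_lt with rfl | h1
      · exact h0.le.trans hs2
      rcases hτ.2.eq_or_lt with rfl | h2
      · exact le_rfl
      · exact (hlt τ ⟨h1, h2⟩).le.trans hs2)
  have hcap : ∀ β, β < 1 → caputoDeriv β (gseries a γ) s < 0 := by
    intro β hβ
    have hΓ : 0 < Real.Gamma (1 - β) := Real.Gamma_pos_of_pos (by linarith)
    refine smul_neg_of_pos_of_neg (inv_pos.2 hΓ) ?_
    have hint := h.caputoRegular.intervalIntegrable β hβ s hs0
    have := intervalIntegral.intervalIntegral_pos_of_pos_on hint.neg (fun τ hτ => ?_) hs0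
    · simp only [Pi.neg_apply, intervalIntegral.integral_neg] at this
      linarith
    · have h1 : deriv (gseries a γ) τ < 0 := by
        rw [h.deriv_eq hτ.1]
        exact mul_neg_of_pos_of_neg (inv_pos.2 hτ.1) (hlt τ hτ)
      have h2 : 0 < (s - τ) ^ (-β) := Real.rpow_pos_of_pos (by linarith [hτ.2]) _
      have := mul_neg_of_pos_of_neg h2 h1
      simp only [Pi.neg_apply, smul_eq_mul]
      linarith
  have heq := h.euler_equation hs0
  have h1 : α * caputoDeriv α (gseries a γ) s < 0 :=
    mul_neg_of_pos_of_neg h.alpha_pos (hcap α h.alpha_lt)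
  have h2 : ∑ i, αs i * (b i * caputoDeriv (αs i) (gseries a γ) s) ≤ 0 :=
    Finset.sum_nonpos fun i _ => mul_nonpos_of_nonneg_of_nonpos (h.alphas i).1.le
      (mul_nonpos_of_nonneg_of_nonpos (h.b_pos i).le
        (hcap _ ((h.alphas i).2.trans h.alpha_lt)).le)
  have h3 : 0 ≤ lam * G s := mul_nonneg h.lam_pos.le hs2
  linarith

theorem deriv_neg [Countable ι] (h : IsModeSeries α αs b lam a γ) {t : ℝ} (ht : 0 < t) :
    deriv (gseries a γ) t < 0 := by
  rw [h.deriv_eq ht]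
  exact mul_neg_of_pos_of_neg (inv_pos.2 ht) (h.euler_neg ht)

theorem apply_zero (h : IsModeSeries α αs b lam a γ) : gseries a γ 0 = 0 :=
  gseries_zero fun i => h.alpha_pos.trans_le (h.le_exponent i)

theorem nonpos [Countable ι] (h : IsModeSeries α αs b lam a γ) {t : ℝ} (ht : 0 ≤ t) :
    gseries a γ t ≤ 0 := by
  have : AntitoneOn (gseries a γ) (Ici 0) := by
    refine antitoneOn_of_deriv_nonpos (convex_Ici 0) h.caputoRegular.continuousOn ?_ ?_
    · rw [interior_Ici]
      exact fun s hs => (h.caputoRegular.differentiableAt s hs).differentiableWithinAt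
    · rw [interior_Ici]
      exact fun s hs => (h.deriv_neg hs).le
  simpa [h.apply_zero] using this (mem_Ici.2 le_rfl) (mem_Ici.2 ht) ht

/-- The maximum principle applied to `y = 1 + g` itself, for which `P(∂ₜ)y + λy = 0`. -/
theorem neg_one_le (h : IsModeSeries α αs b lam a γ) {t : ℝ} (ht : 0 ≤ t) :
    0 ≤ 1 + gseries a γ t := by
  refine ((caputoRegular_const 1).add h.caputoRegular).nonneg_of_multiTermDeriv
    h.alpha_pos h.alpha_lt h.alphas h.b_pos h.lam_pos ?_ (fun s hs => ?_) ht
  · simp [h.apply_zero]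
  · rw [(caputoRegular_const 1).multiTermDeriv_add h.caputoRegular h.alpha_lt h.alphas hs,
      multiTermDeriv_const, h.equation s hs]
    linarith

theorem caputoDeriv_nonpos [Countable ι] (h : IsModeSeries α αs b lam a γ) {β t : ℝ} (hβ : β < 1)
    (ht : 0 < t) : caputoDeriv β (gseries a γ) t ≤ 0 := by
  have hΓ : 0 < Real.Gamma (1 - β) := Real.Gamma_pos_of_pos (by linarith)
  refine smul_nonpos_of_nonneg_of_nonpos (inv_nonneg.2 hΓ.le) ?_
  rw [← neg_nonneg, ← intervalIntegral.integral_neg]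
  refine intervalIntegral.integral_nonneg_of_ae_restrict ht.le ?_
  rw [← restrict_Ioo_eq_restrict_Icc]
  refine (ae_restrict_mem measurableSet_Ioo).mono fun τ hτ => ?_
  have h1 := Real.rpow_nonneg (show 0 ≤ t - τ by linarith [hτ.2]) (-β)
  have := mul_nonpos_of_nonneg_of_nonpos h1 (h.deriv_neg hτ.1).le
  simp only [Pi.zero_apply, smul_eq_mul]
  linarith

/-- As `y` decreases, `∂^{αᵢ} y ≤ 0`, and replacing each weight `αᵢ` by the larger `α` lowers the
right side of the Euler equation to `α P(∂ₜ)y = -αλy`. -/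
theorem euler_supersolution [Countable ι] (h : IsModeSeries α αs b lam a γ) {t : ℝ} (ht : 0 < t) :
    -(α * (lam * (1 + gseries a γ t))) ≤
      multiTermDeriv α αs b (gseries (fun i => a i * γ i) γ) t
        + lam * gseries (fun i => a i * γ i) γ t := by
  rw [h.euler_equation ht, ← mul_neg, ← h.equation t ht, multiTermDeriv, mul_add, Finset.mul_sum]
  refine add_le_add le_rfl (Finset.sum_le_sum fun i _ => ?_)
  rw [smul_eq_mul]
  refine mul_le_mul_of_nonpos_right (h.alphas i).2.le (mul_nonpos_of_nonneg_of_nonpos (h.b_pos i).le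
    (h.caputoDeriv_nonpos ((h.alphas i).2.trans h.alpha_lt) ht))

/-- Adding the constant `α` contributes `αλ`, which compensates `-αλy` because `y ≤ 1`; the maximum
principle applies. -/
theorem neg_alpha_le_euler [Countable ι] (h : IsModeSeries α αs b lam a γ) {t : ℝ} (ht : 0 ≤ t) :
    0 ≤ α + gseries (fun i => a i * γ i) γ t := by
  refine ((caputoRegular_const α).add h.caputoRegular_euler).nonneg_of_multiTermDeriv
    h.alpha_pos h.alpha_lt h.alphas h.b_pos h.lam_pos ?_ (fun s hs => ?_) ht
  · rw [gseries_zero fun i => h.alpha_pos.trans_le (h.le_exponent i)]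
    linarith [h.alpha_pos]
  · rw [(caputoRegular_const α).multiTermDeriv_add h.caputoRegular_euler h.alpha_lt h.alphas hs,
      multiTermDeriv_const]
    have h1 := h.euler_supersolution hs
    have h2 : α * lam * gseries a γ s ≤ 0 :=
      mul_nonpos_of_nonneg_of_nonpos (mul_pos h.alpha_pos h.lam_pos).le (h.nonpos hs.le)
    linarith

/-- The coefficient of the barrier `t^α` is chosen so that its `P(∂ₜ)` is at least `λα ≥ αλy`. This
bound is the sharper one when `λt^α` is small. -/
theorem neg_rpow_le_euler [Countable ι] (h : IsModeSeries α αs b lam a γ) {t : ℝ} (ht : 0 ≤ t) :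
    0 ≤ lam * α / Real.Gamma (α + 1) * t ^ α + gseries (fun i => a i * γ i) γ t := by
  have hΓ : 0 < Real.Gamma (α + 1) := Real.Gamma_pos_of_pos (by linarith [h.alpha_pos])
  have hα := h.alpha_pos
  have hl := h.lam_pos
  have hr := (caputoRegular_rpow h.alpha_pos).const_mul (lam * α / Real.Gamma (α + 1))
  refine (hr.add h.caputoRegular_euler).nonneg_of_multiTermDeriv
    h.alpha_pos h.alpha_lt h.alphas h.b_pos h.lam_pos ?_ (fun s hs => ?_) ht
  · rw [gseries_zero fun i => h.alpha_pos.trans_le (h.le_exponent i), Real.zero_rpow hα.ne']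
    simp
  · rw [hr.multiTermDeriv_add h.caputoRegular_euler h.alpha_lt h.alphas hs,
      (caputoRegular_rpow h.alpha_pos).multiTermDeriv_const_mul _ hs]
    have h1 := h.euler_supersolution hs
    have h2 : α * lam * gseries a γ s ≤ 0 :=
      mul_nonpos_of_nonneg_of_nonpos (mul_pos h.alpha_pos h.lam_pos).le (h.nonpos hs.le)
    have h3 : lam * α ≤ lam * α / Real.Gamma (α + 1) * multiTermDeriv α αs b (fun t : ℝ => t ^ α) s := by
      calc lam * α = lam * α / Real.Gamma (α + 1) * Real.Gamma (α + 1) := by field_simp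
        _ ≤ _ := by
          have := multiTermDeriv_rpow_ge hα h.alpha_lt h.alphas h.b_pos hs
          gcongr
    have h4 : 0 ≤ lam * (lam * α / Real.Gamma (α + 1) * s ^ α) := by positivity
    linarith

/-- Split at `t/2`. On the left half the kernel is at most `(t/2)^(-β)` and the total decrease of
`y` is at most `1`; on the right half `-y' ≤ 1/τ ≤ 2/t` and the kernel is integrable. Nothing
depends on `λ`. -/
theorem neg_caputoDeriv_le [Countable ι] (h : IsModeSeries α αs b lam a γ) {β t : ℝ} (hβ₀ : 0 < β)
    (hβ : β < 1) (ht : 0 < t) :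
    -caputoDeriv β (gseries a γ) t
      ≤ (Real.Gamma (1 - β))⁻¹ * (2 ^ β + 2 / (1 - β)) * t ^ (-β) := by
  have hΓ : 0 < Real.Gamma (1 - β) := Real.Gamma_pos_of_pos (by linarith)
  rw [caputoDeriv, ← smul_neg, ← intervalIntegral.integral_neg, smul_eq_mul, mul_assoc]
  refine mul_le_mul_of_nonneg_left ?_ (inv_nonneg.2 hΓ.le)
  -- Order `0` makes the kernel equal to one.
  have hi0 : IntervalIntegrable (deriv (gseries a γ)) volume 0 t := by
    simpa using h.caputoRegular.intervalIntegrable 0 one_pos t ht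
  have hn : IntervalIntegrable (fun τ => -deriv (gseries a γ) τ) volume 0 t := hi0.neg
  have hFTC : ∫ τ in (0 : ℝ)..t, deriv (gseries a γ) τ = gseries a γ t - gseries a γ 0 :=
    intervalIntegral.integral_eq_sub_of_hasDerivAt_of_le ht.le
      (h.caputoRegular.continuousOn.mono Icc_subset_Ici_self)
      (fun τ hτ => (h.caputoRegular.differentiableAt τ hτ.1).hasDerivAt) hi0
  have hk : IntervalIntegrable (fun τ : ℝ => (t - τ) ^ (-β)) volume 0 t := by
    have := intervalIntegrable_rpow_mul_sub_rpow one_pos (b := 1 - β) (by linarith) ht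
    simpa [show 1 - β - 1 = -β by ring] using this
  have hkI : ∫ τ in (0 : ℝ)..t, (t - τ) ^ (-β) = t ^ (1 - β) / (1 - β) := by
    rw [intervalIntegral.integral_comp_sub_left (fun x => x ^ (-β)) t, sub_self, sub_zero,
      integral_rpow (Or.inl (by linarith)), show -β + 1 = 1 - β by ring,
      Real.zero_rpow (by linarith), sub_zero]
  calc ∫ τ in (0 : ℝ)..t, -((t - τ) ^ (-β) • deriv (gseries a γ) τ)
      ≤ ∫ τ in (0 : ℝ)..t, ((t / 2) ^ (-β) * (-deriv (gseries a γ) τ) + 2 / t * (t - τ) ^ (-β)) := by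
        refine intervalIntegral.integral_mono_on_of_le_Ioo ht.le
          (h.caputoRegular.intervalIntegrable β hβ t ht).neg
          ((hn.const_mul _).add (hk.const_mul _)) fun τ hτ => ?_
        have h1 := h.deriv_neg hτ.1
        have h2 : -deriv (gseries a γ) τ ≤ τ⁻¹ := by
          rw [h.deriv_eq hτ.1, ← mul_neg]
          have := h.neg_alpha_le_euler hτ.1.le
          have h3 := h.alpha_lt
          exact mul_le_of_le_one_right (inv_nonneg.2 hτ.1.le) (by linarith)
        have h4 : 0 ≤ (t - τ) ^ (-β) := Real.rpow_nonneg (by linarith [hτ.2]) _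
        have h5 : 0 ≤ (t / 2) ^ (-β) := by positivity
        rw [smul_eq_mul, ← mul_neg]
        rcases le_total τ (t / 2) with hle | hle
        · have h6 : (t - τ) ^ (-β) ≤ (t / 2) ^ (-β) :=
            Real.rpow_le_rpow_of_nonpos (by positivity) (by linarith) (by linarith)
          have h7 := mul_le_mul_of_nonneg_right h6 (neg_nonneg.2 h1.le)
          have h8 : 0 ≤ 2 / t * (t - τ) ^ (-β) := by positivity
          linarith
        · have h6 : τ⁻¹ ≤ 2 / t := by
            rw [inv_le_comm₀ hτ.1 (by positivity), inv_div]; exact hle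
          have h7 := mul_le_mul_of_nonneg_left (h2.trans h6) h4
          have h8 := mul_nonneg h5 (neg_nonneg.2 h1.le)
          linarith
    _ = (t / 2) ^ (-β) * (-gseries a γ t) + 2 / t * (t ^ (1 - β) / (1 - β)) := by
        rw [intervalIntegral.integral_add (hn.const_mul _) (hk.const_mul _),
          intervalIntegral.integral_const_mul, intervalIntegral.integral_const_mul, hkI,
          intervalIntegral.integral_neg, hFTC, h.apply_zero, sub_zero]
    _ ≤ (t / 2) ^ (-β) * 1 + 2 / t * (t ^ (1 - β) / (1 - β)) := by
        have := h.neg_one_le ht.le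
        gcongr
        linarith
    _ = _ := by
        rw [Real.div_rpow ht.le (by norm_num), Real.rpow_neg (by norm_num : (0 : ℝ) ≤ 2),
          sub_eq_add_neg 1 β, Real.rpow_add ht, Real.rpow_one]
        field_simp

end IsModeSeries

/-! ### The solution factors of the individual modes -/

section Mode

variable {m : ℕ} {α : ℝ} {αs b : Fin m → ℝ} {lam : ℝ}

/-- The exponents `(α, α - α₁, …, α - αₘ)`. -/
noncomputable def modeOrders (α : ℝ) (αs : Fin m → ℝ) : Fin (m + 1) → ℝ :=
  Fin.cons α (fun i => α - αs i)

/-- The coefficients `(-λ, -b₁, …, -bₘ)`. -/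
noncomputable def modeArgs (b : Fin m → ℝ) (lam : ℝ) : Fin (m + 1) → ℝ :=
  Fin.cons (-lam) (fun i => -b i)

/-- The coefficients of the generalized power series of `modeFactor α αs b lam - 1`. -/
noncomputable def modeCoeff (α : ℝ) (αs b : Fin m → ℝ) (lam : ℝ) (i : MLIndex (m + 1)) : ℝ :=
  -lam * (mlCoeff (modeArgs b lam) i / Real.Gamma (1 + mlExp (modeOrders α αs) α i))

theorem modeOrders_pos (hα₀ : 0 < α) (hαs : ∀ i, 0 < αs i ∧ αs i < α) (i : Fin (m + 1)) :
    0 < modeOrders α αs i := by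
  refine Fin.cases ?_ (fun j => ?_) i
  · simpa [modeOrders] using hα₀
  · simpa [modeOrders] using (hαs j).2

theorem gseries_modeCoeff :
    gseries (modeCoeff α αs b lam) (mlExp (modeOrders α αs) α)
      = fun t => -lam * mlSeries (modeOrders α αs) (modeArgs b lam) α t := by
  funext t
  rw [mlSeries, gseries, gseries, ← tsum_mul_left]
  exact tsum_congr fun i => by rw [modeCoeff, mul_assoc]

theorem modeFactor_eq (hα₀ : 0 < α) (hαs : ∀ i, 0 < αs i ∧ αs i < α) {t : ℝ} (ht : 0 ≤ t) :
    modeFactor α αs b lam t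
      = 1 + gseries (modeCoeff α αs b lam) (mlExp (modeOrders α αs) α) t := by
  have hpos := modeOrders_pos hα₀ hαs
  rcases ht.eq_or_lt with rfl | ht
  · rw [gseries_zero fun i => hα₀.trans_le (le_mlExp hpos α i)]
    simp [modeFactor, Real.zero_rpow hα₀.ne']
  · have e : (Fin.cons (-(lam * t ^ α)) (fun i => -(b i * t ^ (α - αs i))) : Fin (m + 1) → ℝ)
        = fun i => modeArgs b lam i * t ^ modeOrders α αs i := by
      funext i
      refine Fin.cases ?_ (fun j => ?_) i <;> simp [modeArgs, modeOrders]
    rw [gseries_modeCoeff]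
    beta_reduce
    rw [← mul_multinomialML hpos (modeArgs b lam) hα₀.le ht, modeFactor, e, modeOrders]
    ring

theorem isEntireSeries_modeCoeff (hα₀ : 0 < α) (hαs : ∀ i, 0 < αs i ∧ αs i < α) :
    IsEntireSeries (modeCoeff α αs b lam) (mlExp (modeOrders α αs) α) := by
  have h := isEntireSeries_mlSeries (modeOrders_pos hα₀ hαs) (modeArgs b lam) hα₀.le
  refine ⟨h.nonneg, fun R hR => ((h.summable R hR).mul_left |lam|).congr fun i => ?_⟩
  rw [modeCoeff, abs_mul (-lam), abs_neg, mul_assoc]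

/-- Write `Y_μ` for `mlSeries` with parameter `μ`. Then `P(∂ₜ)Y_α = Y₀ + ∑ bᵢ Y_{α-αᵢ}`, and
`mlSeries_zero` reads `Y₀ = 1 - λY_α - ∑ bᵢ Y_{α-αᵢ}`; the sums cancel. -/
theorem multiTermDeriv_gseries_modeCoeff (hα₀ : 0 < α) (hα₁ : α < 1)
    (hαs : ∀ i, 0 < αs i ∧ αs i < α) {t : ℝ} (ht : 0 < t) :
    multiTermDeriv α αs b (gseries (modeCoeff α αs b lam) (mlExp (modeOrders α αs) α)) t
      = -(lam * (1 + gseries (modeCoeff α αs b lam) (mlExp (modeOrders α αs) α) t)) := by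
  have hpos := modeOrders_pos hα₀ hαs
  have hreg : CaputoRegular (mlSeries (modeOrders α αs) (modeArgs b lam) α) :=
    (isEntireSeries_mlSeries hpos (modeArgs b lam) hα₀.le).caputoRegular hα₀ (le_mlExp hpos α)
  have h1 : ∀ i, caputoDeriv (αs i) (mlSeries (modeOrders α αs) (modeArgs b lam) α) t
      = mlSeries (modeOrders α αs) (modeArgs b lam) (α - αs i) t := fun i =>
    caputoDeriv_mlSeries hpos _ hα₀ ((hαs i).2.trans hα₁) ht
  have h2 := mlSeries_zero hpos (modeArgs b lam) ht
  rw [Fin.sum_univ_succ] at h2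
  simp only [modeOrders, modeArgs, Fin.cons_zero, Fin.cons_succ, neg_mul,
    Finset.sum_neg_distrib] at h2
  rw [gseries_modeCoeff, hreg.multiTermDeriv_const_mul (-lam) ht, multiTermDeriv,
    caputoDeriv_mlSeries hpos _ hα₀ hα₁ ht, sub_self]
  simp only [h1, smul_eq_mul]
  simp only [modeOrders, modeArgs]
  rw [h2]
  ring

/-- After division by `t^α` the series is continuous at `0`, where only the zero multi-index
survives, with the negative coefficient `-λα/Γ(1+α)`. -/
theorem euler_modeCoeff_neg_near_zero (hα₀ : 0 < α) (hαs : ∀ i, 0 < αs i ∧ αs i < α)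
    (hlam : 0 < lam) :
    ∃ ε : ℝ, 0 < ε ∧ ∀ t ∈ Ioo 0 ε, gseries
      (fun i => modeCoeff α αs b lam i * mlExp (modeOrders α αs) α i)
        (mlExp (modeOrders α αs) α) t < 0 := by
  have hpos := modeOrders_pos hα₀ hαs
  set γ := mlExp (modeOrders α αs) α with hγ
  set c : MLIndex (m + 1) → ℝ := fun i => modeCoeff α αs b lam i * γ i with hc
  have hent : IsEntireSeries c γ := (isEntireSeries_modeCoeff hα₀ hαs).mul_exponent
  have hent' : IsEntireSeries c (fun i => γ i - α) := by
    refine ⟨fun i => sub_nonneg.2 (le_mlExp hpos α i), fun R hR => ?_⟩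
    refine ((hent.summable R hR).mul_right (R ^ (-α))).congr fun i => ?_
    rw [sub_eq_add_neg, Real.rpow_add hR, mul_assoc]
  let i₀ : MLIndex (m + 1) := ⟨0, ⟨0, by simp⟩⟩
  -- The convention `0 ^ 0 = 1` keeps the term of exponent zero.
  have h0 : gseries c (fun i => γ i - α) 0 = c i₀ := by
    rw [gseries, tsum_eq_single i₀]
    · simp [hγ, mlExp, i₀]
    · rintro ⟨k, l, hl⟩ hne
      have hl' := hl
      rw [Finset.mem_piAntidiag] at hl'
      have hne' : ∃ j, l j ≠ 0 := by
        by_contra! hz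
        apply hne
        have hl0 : l = 0 := funext hz
        subst hl0
        have hk : k = 0 := by simpa using hl'.1.symm
        subst hk
        rfl
      obtain ⟨j, hj⟩ := hne'
      have hp : 0 < γ ⟨k, l, hl⟩ - α := by
        rw [hγ, mlExp, add_sub_cancel_left]
        refine Finset.sum_pos' (fun j _ => mul_nonneg (hpos j).le (Nat.cast_nonneg _))
          ⟨j, Finset.mem_univ j, mul_pos (hpos j) ?_⟩
        exact_mod_cast Nat.pos_of_ne_zero hj
      rw [Real.zero_rpow hp.ne', mul_zero]
  have hneg : c i₀ < 0 := by
    have h1 : γ i₀ = α := by simp [hγ, mlExp, i₀]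
    have h2 : mlCoeff (modeArgs b lam) i₀ = 1 := by simp [mlCoeff, i₀, Nat.multinomial]
    have hΓ : 0 < Real.Gamma (1 + α) := Real.Gamma_pos_of_pos (by linarith)
    simp only [hc, modeCoeff, h2]
    rw [← hγ, h1]
    have : 0 < lam * (1 / Real.Gamma (1 + α)) * α := by positivity
    linarith
  have hcont := (hent'.continuousOn one_pos) 0 ⟨le_rfl, zero_le_one⟩
  rw [ContinuousWithinAt, h0] at hcont
  have hev := hcont.eventually (gt_mem_nhds hneg)
  rw [nhdsWithin_Icc_eq_nhdsGE one_pos, (nhdsGE_basis (0 : ℝ)).eventually_iff] at hev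
  obtain ⟨ε, hε, hev⟩ := hev
  refine ⟨ε, hε, fun t ht => ?_⟩
  have h1 := hev ⟨ht.1.le, ht.2⟩
  have h2 : gseries c γ t = t ^ α * gseries c (fun i => γ i - α) t := by
    rw [gseries, gseries, ← tsum_mul_left]
    refine tsum_congr fun i => ?_
    rw [mul_left_comm, ← Real.rpow_add ht.1, add_sub_cancel]
  rw [h2]
  exact mul_neg_of_pos_of_neg (Real.rpow_pos_of_pos ht.1 _) h1

theorem isModeSeries_modeCoeff (hα₀ : 0 < α) (hα₁ : α < 1) (hαs : ∀ i, 0 < αs i ∧ αs i < α)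
    (hb : ∀ i, 0 < b i) (hlam : 0 < lam) :
    IsModeSeries α αs b lam (modeCoeff α αs b lam) (mlExp (modeOrders α αs) α) where
  alpha_pos := hα₀
  alpha_lt := hα₁
  alphas := hαs
  b_pos := hb
  lam_pos := hlam
  entire := isEntireSeries_modeCoeff hα₀ hαs
  le_exponent := le_mlExp (modeOrders_pos hα₀ hαs) α
  equation := fun _ ht => multiTermDeriv_gseries_modeCoeff hα₀ hα₁ hαs ht
  neg_near_zero := euler_modeCoeff_neg_near_zero hα₀ hαs hlam

theorem modeFactor_eventuallyEq (hα₀ : 0 < α) (hαs : ∀ i, 0 < αs i ∧ αs i < α) {t : ℝ}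
    (ht : 0 < t) :
    modeFactor α αs b lam
      =ᶠ[𝓝 t] fun t => 1 + gseries (modeCoeff α αs b lam) (mlExp (modeOrders α αs) α) t := by
  filter_upwards [lt_mem_nhds ht] with s hs using modeFactor_eq hα₀ hαs (le_of_lt hs)

theorem deriv_modeFactor (hα₀ : 0 < α) (hαs : ∀ i, 0 < αs i ∧ αs i < α) {t : ℝ} (ht : 0 < t) :
    deriv (modeFactor α αs b lam) t
      = deriv (gseries (modeCoeff α αs b lam) (mlExp (modeOrders α αs) α)) t := by
  rw [(modeFactor_eventuallyEq hα₀ hαs ht).deriv_eq, deriv_const_add]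

theorem differentiableAt_modeFactor (hα₀ : 0 < α) (hαs : ∀ i, 0 < αs i ∧ αs i < α) {t : ℝ}
    (ht : 0 < t) : DifferentiableAt ℝ (modeFactor α αs b lam) t :=
  (((isEntireSeries_modeCoeff hα₀ hαs).hasDerivAt ht).differentiableAt.const_add
    1).congr_of_eventuallyEq (modeFactor_eventuallyEq hα₀ hαs ht)

theorem caputoDeriv_modeFactor (hα₀ : 0 < α) (hαs : ∀ i, 0 < αs i ∧ αs i < α) (β : ℝ) {t : ℝ}
    (ht : 0 < t) :
    caputoDeriv β (modeFactor α αs b lam) t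
      = caputoDeriv β (gseries (modeCoeff α αs b lam) (mlExp (modeOrders α αs) α)) t := by
  rw [caputoDeriv, caputoDeriv]
  congr 1
  refine intervalIntegral.integral_congr_ae (ae_of_all _ fun τ hτ => ?_)
  rw [uIoc_of_le ht.le] at hτ
  rw [deriv_modeFactor hα₀ hαs hτ.1]

theorem multiTermDeriv_modeFactor (hα₀ : 0 < α) (hα₁ : α < 1) (hαs : ∀ i, 0 < αs i ∧ αs i < α)
    {t : ℝ} (ht : 0 < t) :
    multiTermDeriv α αs b (modeFactor α αs b lam) t = -(lam * modeFactor α αs b lam t) := by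
  rw [modeFactor_eq hα₀ hαs ht.le, ← multiTermDeriv_gseries_modeCoeff hα₀ hα₁ hαs ht]
  simp only [multiTermDeriv, caputoDeriv_modeFactor hα₀ hαs _ ht]

theorem modeFactor_nonneg (hα₀ : 0 < α) (hα₁ : α < 1) (hαs : ∀ i, 0 < αs i ∧ αs i < α)
    (hb : ∀ i, 0 < b i) (hlam : 0 < lam) {t : ℝ} (ht : 0 ≤ t) : 0 ≤ modeFactor α αs b lam t := by
  rw [modeFactor_eq hα₀ hαs ht]
  exact (isModeSeries_modeCoeff hα₀ hα₁ hαs hb hlam).neg_one_le ht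

theorem modeFactor_le_one (hα₀ : 0 < α) (hα₁ : α < 1) (hαs : ∀ i, 0 < αs i ∧ αs i < α)
    (hb : ∀ i, 0 < b i) (hlam : 0 < lam) {t : ℝ} (ht : 0 ≤ t) : modeFactor α αs b lam t ≤ 1 := by
  rw [modeFactor_eq hα₀ hαs ht]
  linarith [(isModeSeries_modeCoeff hα₀ hα₁ hαs hb hlam).nonpos ht]

theorem tendsto_modeFactor (hα₀ : 0 < α) (hαs : ∀ i, 0 < αs i ∧ αs i < α) :
    Tendsto (modeFactor α αs b lam) (𝓝[>] 0) (𝓝 1) := by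
  have hpos := modeOrders_pos hα₀ hαs
  have hc := ((isEntireSeries_modeCoeff (b := b) (lam := lam) hα₀ hαs).caputoRegular hα₀
    (le_mlExp hpos α)).continuousOn 0 (mem_Ici.2 le_rfl)
  rw [ContinuousWithinAt, gseries_zero fun i => hα₀.trans_le (le_mlExp hpos α i)] at hc
  have := (hc.mono_left (nhdsWithin_mono 0 Ioi_subset_Ici_self)).const_add 1
  rw [add_zero] at this
  refine this.congr' ?_
  filter_upwards [self_mem_nhdsWithin] with t ht using (modeFactor_eq hα₀ hαs (le_of_lt ht)).symm

/-- The derivative of a mode factor is at most `M λ^θ t^{αθ-1}` for all `θ ∈ [0, 1]`. -/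
theorem abs_deriv_modeFactor_le (hα₀ : 0 < α) (hα₁ : α < 1) (hαs : ∀ i, 0 < αs i ∧ αs i < α)
    (hb : ∀ i, 0 < b i) (hlam : 0 < lam) {θ t : ℝ} (hθ₀ : 0 ≤ θ) (hθ₁ : θ ≤ 1) (ht : 0 < t) :
    |deriv (modeFactor α αs b lam) t|
      ≤ (1 + α / Real.Gamma (α + 1)) * lam ^ θ * t ^ (α * θ - 1) := by
  have h := isModeSeries_modeCoeff hα₀ hα₁ hαs hb hlam
  have hΓ : 0 < Real.Gamma (α + 1) := Real.Gamma_pos_of_pos (by linarith)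
  rw [deriv_modeFactor hα₀ hαs ht, abs_of_neg (h.deriv_neg ht), h.deriv_eq ht, ← mul_neg]
  have h1 := h.neg_alpha_le_euler ht.le
  have h2 := h.neg_rpow_le_euler ht.le
  set G := gseries (fun i => modeCoeff α αs b lam i * mlExp (modeOrders α αs) α i)
    (mlExp (modeOrders α αs) α) t
  set x := lam * t ^ α with hx
  have hx0 : 0 < x := by positivity
  -- The bound linear in `x` is used for `x ≤ 1`, the constant one for `x ≥ 1`; in both cases `min 1
  -- x ≤ x^θ` for `θ ∈ [0, 1]`.
  have hG : -G ≤ (1 + α / Real.Gamma (α + 1)) * x ^ θ := by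
    have h5 : 0 ≤ α / Real.Gamma (α + 1) := by positivity
    rcases le_total x 1 with hle | hle
    · have h3 : x ≤ x ^ θ := by
        simpa using Real.rpow_le_rpow_of_exponent_ge hx0 hle hθ₁
      have h4 : -G ≤ α / Real.Gamma (α + 1) * x := by
        have e : lam * α / Real.Gamma (α + 1) * t ^ α = α / Real.Gamma (α + 1) * x := by
          rw [hx]; ring
        linarith
      have := mul_le_mul_of_nonneg_left h3 h5
      nlinarith
    · have h3 : 1 ≤ x ^ θ := Real.one_le_rpow hle hθ₀
      nlinarith
  calc t⁻¹ * -G ≤ t⁻¹ * ((1 + α / Real.Gamma (α + 1)) * x ^ θ) := by gcongr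
    _ = _ := by
      rw [hx, Real.mul_rpow hlam.le (by positivity), ← Real.rpow_mul ht.le,
        Real.rpow_sub_one ht.ne']
      field_simp

/-- For `s = 1` the equation gives `λy = -P(∂ₜ)y`, and each Caputo derivative is bounded
independently of `λ`; `T` enters through `t^{-αᵢ} ≤ T^{α-αᵢ} t^{-α}`. Smaller `s` follow from `0 ≤ y
≤ 1` and `x^s ≤ 1 + x` with `x = λt^α`. -/
theorem exists_rpow_mul_modeFactor_le (hα₀ : 0 < α) (hα₁ : α < 1)
    (hαs : ∀ i, 0 < αs i ∧ αs i < α) (hb : ∀ i, 0 < b i) (T : ℝ) :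
    ∃ C : ℝ, 0 < C ∧ ∀ lam : ℝ, 0 < lam → ∀ s : ℝ, 0 ≤ s → s ≤ 1 → ∀ t ∈ Ioc 0 T,
      lam ^ s * modeFactor α αs b lam t ≤ C * t ^ (-(α * s)) := by
  let D : ℝ → ℝ := fun β => (Real.Gamma (1 - β))⁻¹ * (2 ^ β + 2 / (1 - β))
  have hD : ∀ β, β < 1 → 0 < D β := fun β hβ => by
    have hΓ : 0 < Real.Gamma (1 - β) := Real.Gamma_pos_of_pos (by linarith)
    have : 0 < 1 - β := by linarith
    positivity
  have hDi : ∀ i, 0 < D (αs i) := fun i => hD _ ((hαs i).2.trans hα₁)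
  have hDα := hD α hα₁
  have hsum : ∀ T : ℝ, 0 < T → 0 ≤ ∑ i, b i * (D (αs i) * T ^ (α - αs i)) := fun T hT =>
    Finset.sum_nonneg fun i _ => by
      have := hb i
      have := hDi i
      positivity
  refine ⟨1 + |D α + ∑ i, b i * (D (αs i) * T ^ (α - αs i))|, by positivity,
    fun lam hlam s hs₀ hs₁ t ht => ?_⟩
  have ht0 := ht.1
  have h := isModeSeries_modeCoeff hα₀ hα₁ hαs hb hlam
  have hF0 := modeFactor_nonneg hα₀ hα₁ hαs hb hlam ht0.le
  have hF1 := modeFactor_le_one hα₀ hα₁ hαs hb hlam ht0.le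
  set F := modeFactor α αs b lam t with hF
  have h1 : lam * F ≤ (D α + ∑ i, b i * (D (αs i) * T ^ (α - αs i))) * t ^ (-α) := by
    have e : lam * F = -caputoDeriv α (modeFactor α αs b lam) t
        + ∑ i, b i * -caputoDeriv (αs i) (modeFactor α αs b lam) t := by
      have := multiTermDeriv_modeFactor (b := b) (lam := lam) hα₀ hα₁ hαs ht0
      simp only [multiTermDeriv, smul_eq_mul] at this
      simp only [mul_neg, Finset.sum_neg_distrib]
      linarith
    rw [e, add_mul, Finset.sum_mul]
    refine add_le_add ?_ (Finset.sum_le_sum fun i _ => ?_)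
    · rw [caputoDeriv_modeFactor hα₀ hαs _ ht0]
      exact h.neg_caputoDeriv_le hα₀ hα₁ ht0
    · rw [caputoDeriv_modeFactor hα₀ hαs _ ht0, mul_assoc]
      refine mul_le_mul_of_nonneg_left ?_ (hb i).le
      refine (h.neg_caputoDeriv_le (hαs i).1 ((hαs i).2.trans hα₁) ht0).trans ?_
      rw [mul_assoc (D (αs i))]
      refine mul_le_mul_of_nonneg_left ?_ (hDi i).le
      rw [show -αs i = (α - αs i) + -α by ring, Real.rpow_add ht0]
      have := Real.rpow_le_rpow ht0.le ht.2 (sub_nonneg.2 (hαs i).2.le)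
      gcongr
  set C₀ := D α + ∑ i, b i * (D (αs i) * T ^ (α - αs i))
  have htα : 0 < t ^ α := Real.rpow_pos_of_pos ht0 _
  have h2 : lam * t ^ α * F ≤ C₀ := by
    rw [Real.rpow_neg ht0.le, ← div_eq_mul_inv, le_div_iff₀ htα] at h1
    linarith
  set x := lam * t ^ α with hx
  have hx0 : 0 < x := by positivity
  have h3 : x ^ s * F ≤ 1 + |C₀| := by
    have h4 : x ^ s ≤ 1 + x := by
      rcases le_total x 1 with hle | hle
      · linarith [Real.rpow_le_one hx0.le hle hs₀]
      · have := Real.rpow_le_rpow_of_exponent_le hle hs₁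
        rw [Real.rpow_one] at this
        linarith
    calc x ^ s * F ≤ (1 + x) * F := by gcongr
      _ = F + x * F := by ring
      _ ≤ 1 + |C₀| := add_le_add hF1 (h2.trans (le_abs_self _))
  rw [hx, Real.mul_rpow hlam.le htα.le, ← Real.rpow_mul ht0.le] at h3
  rw [Real.rpow_neg ht0.le, ← div_eq_mul_inv, le_div_iff₀ (Real.rpow_pos_of_pos ht0 _)]
  linarith

end Mode

/-! ### The Poincaré inequality and positivity of the eigenvalues -/

section Poincare

variable {d : ℕ} {Ω : Set (EuclideanSpace ℝ (Fin d))}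

theorem IsConvexPolygonalDomain.isBounded (h : IsConvexPolygonalDomain Ω) :
    Bornology.IsBounded Ω := by
  obtain ⟨-, S, hS, rfl⟩ := h
  exact (isBounded_convexHull.2 hS.isBounded).subset interior_subset

/-- Integrate `ψ²` by parts against the first coordinate, which is bounded by `R` on `Ω`, and absorb
half of `∫ ψ²` by Young's inequality. -/
theorem integral_sq_le_integral_gradient_sq (hd : 1 ≤ d) {R : ℝ}
    (hR : ∀ x ∈ Ω, ‖x‖ ≤ R) {ψ : EuclideanSpace ℝ (Fin d) → ℝ} (hψ : ContDiff ℝ ∞ ψ)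
    (hc : HasCompactSupport ψ) (hs : tsupport ψ ⊆ Ω) :
    ∫ x, ψ x ^ 2 ≤ 4 * R ^ 2 * ∫ x, ‖gradient ψ x‖ ^ 2 := by
  let i₀ : Fin d := ⟨0, hd⟩
  let v : EuclideanSpace ℝ (Fin d) := EuclideanSpace.single i₀ 1
  let L : EuclideanSpace ℝ (Fin d) →L[ℝ] ℝ := innerSL ℝ v
  have hv : ‖v‖ = 1 := by simp [v]
  have hLv : L v = 1 := by
    change ⟪v, v⟫ = 1
    rw [real_inner_self_eq_norm_sq, hv]; norm_num
  have hψ1 : Differentiable ℝ ψ := hψ.differentiable (by simp)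
  have hψc : Continuous ψ := hψ.continuous
  have hfd : Continuous (fderiv ℝ ψ) := hψ.continuous_fderiv (by simp)
  have hder : ∀ x, fderiv ℝ (fun y => ψ y ^ 2) x v = 2 * ψ x * fderiv ℝ ψ x v := by
    intro x
    have := ((hψ1 x).hasFDerivAt.pow 2).fderiv
    rw [this]
    simp
  have hgn : ∀ x, |fderiv ℝ ψ x v| ≤ ‖gradient ψ x‖ := by
    intro x
    have h1 := (fderiv ℝ ψ x).le_opNorm v
    rw [hv, mul_one, Real.norm_eq_abs] at h1
    rwa [← toDual_gradient, LinearIsometryEquiv.norm_map, toDual_gradient] at h1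
  have hgc : Continuous fun x => ‖gradient ψ x‖ := by
    have : (fun x => ‖gradient ψ x‖) = fun x => ‖fderiv ℝ ψ x‖ := by
      funext x
      rw [← toDual_gradient, LinearIsometryEquiv.norm_map]
    rw [this]
    exact hfd.norm
  have hgs : HasCompactSupport fun x => ‖gradient ψ x‖ ^ 2 := by
    have : (fun x => ‖gradient ψ x‖ ^ 2) = fun x => ‖fderiv ℝ ψ x‖ ^ 2 := by
      funext x
      rw [← toDual_gradient, LinearIsometryEquiv.norm_map]
    rw [this]
    exact (hc.fderiv ℝ).comp_left (g := fun y => ‖y‖ ^ 2) (by simp)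
  have hsq : HasCompactSupport fun x => ψ x ^ 2 := hc.comp_left (g := fun y => y ^ 2) (by simp)
  have hI1 : Integrable (fun x => ψ x ^ 2) := (hψc.pow 2).integrable_of_hasCompactSupport hsq
  have hI2 : Integrable (fun x => ‖gradient ψ x‖ ^ 2) :=
    (hgc.pow 2).integrable_of_hasCompactSupport hgs
  have hfv : Continuous fun x => fderiv ℝ ψ x v := hfd.clm_apply continuous_const
  have hI3 : Integrable fun x => fderiv ℝ (fun y => ψ y ^ 2) x v * L x := by
    simp only [hder]
    refine Continuous.integrable_of_hasCompactSupport (by fun_prop) ?_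
    exact (HasCompactSupport.mul_right (HasCompactSupport.mul_right
      (HasCompactSupport.mul_left hc)))
  have hIBP := integral_mul_fderiv_eq_neg_fderiv_mul_of_integrable (μ := volume) (v := v)
    (f := fun x => ψ x ^ 2) (g := fun x => L x) hI3 (by
      simp only [ContinuousLinearMap.fderiv, hLv, mul_one]
      exact hI1)
    ((hψc.pow 2).mul L.continuous |>.integrable_of_hasCompactSupport hsq.mul_right)
    (fun x _ => (hψ1 x).pow 2) (fun x _ => L.differentiableAt)
  simp only [ContinuousLinearMap.fderiv, hLv, mul_one] at hIBP
  have hbound : ∫ x, ψ x ^ 2 ≤ ∫ x, (1 / 2 * ψ x ^ 2 + 2 * R ^ 2 * ‖gradient ψ x‖ ^ 2) := by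
    rw [hIBP, ← integral_neg]
    refine integral_mono hI3.neg ((hI1.const_mul _).add (hI2.const_mul _)) fun x => ?_
    simp only [hder]
    by_cases hx : ψ x = 0
    · simp only [hx]
      simp only [mul_zero, zero_mul, neg_zero]
      positivity
    · have hxΩ : x ∈ Ω := hs (subset_tsupport ψ hx)
      have hL : |L x| ≤ R := by
        have h1 : |⟪v, x⟫| ≤ ‖v‖ * ‖x‖ := abs_real_inner_le_norm v x
        rw [hv, one_mul] at h1
        exact h1.trans (hR x hxΩ)
      have h2 : |fderiv ℝ ψ x v * L x| ≤ ‖gradient ψ x‖ * R := by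
        rw [abs_mul]
        exact mul_le_mul (hgn x) hL (abs_nonneg _) (norm_nonneg _)
      have h3 := mul_le_mul_of_nonneg_left h2 (abs_nonneg (ψ x))
      rw [← abs_mul] at h3
      have h4 := neg_abs_le (ψ x * (fderiv ℝ ψ x v * L x))
      have h5 := sq_nonneg (|ψ x| - 2 * (‖gradient ψ x‖ * R))
      have h6 := sq_abs (ψ x)
      nlinarith
  rw [integral_add (hI1.const_mul _) (hI2.const_mul _), integral_const_mul, integral_const_mul]
    at hbound
  linarith

/-- The graph of the gradient on test functions is already a subspace, so elements of `H¹₀(Ω)` are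
limits of single test functions. -/
theorem mem_testGraph_of_mem_span {w : WithLp 2 (L2 Ω × L2Vec Ω)}
    (hw : w ∈ Submodule.span ℝ (testGraph Ω)) : w ∈ testGraph Ω := by
  induction hw using Submodule.span_induction with
  | mem w hw => exact hw
  | zero =>
    refine ⟨0, contDiff_const, HasCompactSupport.zero, by simp [tsupport], Lp.coeFn_zero _ _ _, ?_⟩
    refine (Lp.coeFn_zero _ _ _).trans (Eventually.of_forall fun x => ?_)
    simp [gradient]
  | add w₁ w₂ _ _ h₁ h₂ =>
    obtain ⟨ψ₁, hd₁, hc₁, hs₁, hf₁, hg₁⟩ := h₁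
    obtain ⟨ψ₂, hd₂, hc₂, hs₂, hf₂, hg₂⟩ := h₂
    refine ⟨ψ₁ + ψ₂, hd₁.add hd₂, hc₁.add hc₂,
      (tsupport_add ψ₁ ψ₂).trans (union_subset hs₁ hs₂), ?_, ?_⟩
    · exact (Lp.coeFn_add _ _).trans (hf₁.add hf₂)
    · refine ((Lp.coeFn_add _ _).trans (hg₁.add hg₂)).trans (Eventually.of_forall fun x => ?_)
      simp only [Pi.add_apply, gradient]
      rw [fderiv_add (hd₁.differentiable (by simp) x) (hd₂.differentiable (by simp) x), map_add]
  | smul c w _ h =>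
    obtain ⟨ψ, hd, hc, hs, hf, hg⟩ := h
    refine ⟨c • ψ, contDiff_const.smul hd, hc.smul_left (f := fun _ => c),
      (tsupport_smul_subset_right (fun _ => c) ψ).trans hs, ?_, ?_⟩
    · exact (Lp.coeFn_smul _ _).trans (hf.const_smul c)
    · refine ((Lp.coeFn_smul _ _).trans (hg.const_smul c)).trans (Eventually.of_forall fun x => ?_)
      simp only [Pi.smul_apply, gradient]
      rw [fderiv_const_smul (hd.differentiable (by simp) x), map_smul]

/-- The Poincaré inequality on `H¹₀(Ω)`. -/
theorem exists_norm_toL2_le (hd : 1 ≤ d) (hΩ : IsConvexPolygonalDomain Ω) :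
    ∃ K : ℝ, ∀ w : H10 Ω, ‖toL2 Ω w‖ ≤ K * ‖grad Ω w‖ := by
  obtain ⟨R, hR₀, hR⟩ := hΩ.isBounded.exists_pos_norm_le
  refine ⟨2 * R, fun w => ?_⟩
  have hcl : IsClosed {w : WithLp 2 (L2 Ω × L2Vec Ω) | ‖w.fst‖ ≤ 2 * R * ‖w.snd‖} :=
    isClosed_le (WithLp.fstL 2 ℝ (L2 Ω) (L2Vec Ω)).continuous.norm
      (continuous_const.mul (WithLp.sndL 2 ℝ (L2 Ω) (L2Vec Ω)).continuous.norm)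
  refine closure_minimal (fun w hw => ?_) hcl w.2
  obtain ⟨ψ, hψ, hc, hs, hf, hg⟩ := mem_testGraph_of_mem_span hw
  have h1 : ‖w.fst‖ ^ 2 = ∫ x, ψ x ^ 2 := by
    rw [← real_inner_self_eq_norm_sq, L2.inner_def]
    rw [← setIntegral_eq_integral_of_forall_compl_eq_zero (s := Ω) (f := fun x => ψ x ^ 2)]
    · refine integral_congr_ae (hf.mono fun x hx => ?_)
      simp only [hx, real_inner_self_eq_norm_sq, Real.norm_eq_abs, sq_abs]
    · intro x hx
      rw [image_eq_zero_of_notMem_tsupport fun h => hx (hs h)]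
      norm_num
  have h2 : ‖w.snd‖ ^ 2 = ∫ x, ‖gradient ψ x‖ ^ 2 := by
    rw [← real_inner_self_eq_norm_sq, L2.inner_def]
    rw [← setIntegral_eq_integral_of_forall_compl_eq_zero (s := Ω)
      (f := fun x => ‖gradient ψ x‖ ^ 2)]
    · refine integral_congr_ae (hg.mono fun x hx => ?_)
      simp only [hx, real_inner_self_eq_norm_sq]
    · intro x hx
      have : fderiv ℝ ψ x = 0 :=
        image_eq_zero_of_notMem_tsupport fun h => hx (hs (tsupport_fderiv_subset ℝ h))
      simp [gradient, this]
  have h3 := integral_sq_le_integral_gradient_sq hd hR hψ hc hs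
  rw [← h1, ← h2] at h3
  refine (pow_le_pow_iff_left₀ (norm_nonneg _) (by positivity) two_ne_zero).1 ?_
  rw [mul_pow, mul_pow]
  linarith

end Poincare

/-! ### The Riesz isomorphism of `H¹₀(Ω)` and the normalized eigenfunctions. -/

section Riesz

variable {d : ℕ} {Ω : Set (EuclideanSpace ℝ (Fin d))}

theorem inner_H10 (w χ : H10 Ω) :
    ⟪w, χ⟫ = ⟪toL2 Ω w, toL2 Ω χ⟫ + ⟪grad Ω w, grad Ω χ⟫ :=
  WithLp.prod_inner_apply _ _

/-- The Riesz isomorphism of `H¹₀(Ω)` is `1 - Δ`. -/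
theorem toDual_H10 (w : H10 Ω) :
    InnerProductSpace.toDual ℝ (H10 Ω) w = embed w - laplacian w := by
  ext χ
  rw [InnerProductSpace.toDual_apply_apply, inner_H10]
  simp [embed, laplacian]

theorem IsDirichletEigenpair.inner_grad {μ : ℝ} {w : H10 Ω} (h : IsDirichletEigenpair μ w)
    (χ : H10 Ω) : ⟪grad Ω w, grad Ω χ⟫ = μ * ⟪toL2 Ω w, toL2 Ω χ⟫ := by
  have := congrArg (fun f : HNegOne Ω => f χ) h.2
  simpa [embed, laplacian] using this

theorem IsDirichletEigenpair.toDual_eq {μ : ℝ} {w : H10 Ω} (h : IsDirichletEigenpair μ w) :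
    InnerProductSpace.toDual ℝ (H10 Ω) w = (1 + μ) • embed w := by
  rw [toDual_H10, sub_eq_add_neg, h.2, add_smul, one_smul]

/-- Testing the eigenvalue equation with `w` gives `‖∇w‖² = μ‖w‖²`; if `μ ≤ 0` then `∇w = 0`, and
Poincaré forces `w = 0`. -/
theorem IsDirichletEigenpair.pos (hd : 1 ≤ d) (hΩ : IsConvexPolygonalDomain Ω) {μ : ℝ} {w : H10 Ω}
    (h : IsDirichletEigenpair μ w) : 0 < μ := by
  obtain ⟨K, hK⟩ := exists_norm_toL2_le hd hΩ
  have h1 := h.inner_grad w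
  rw [real_inner_self_eq_norm_sq, real_inner_self_eq_norm_sq] at h1
  by_contra! hμ
  have h2 : ‖grad Ω w‖ = 0 := by
    have := mul_nonpos_of_nonpos_of_nonneg hμ (sq_nonneg ‖toL2 Ω w‖)
    have h3 := sq_nonneg ‖grad Ω w‖
    exact pow_eq_zero_iff (two_ne_zero) |>.1 (by linarith)
  have h3 : ‖toL2 Ω w‖ = 0 := by
    have := hK w
    rw [h2, mul_zero] at this
    exact le_antisymm this (norm_nonneg _)
  apply h.1
  rw [← inner_self_eq_zero (𝕜 := ℝ), inner_H10, real_inner_self_eq_norm_sq,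
    real_inner_self_eq_norm_sq, h2, h3]
  norm_num

variable {lam : ℕ → ℝ} {φ : ℕ → H10 Ω}

/-- The eigenfunctions, normalized in `H¹₀(Ω)`. -/
noncomputable def unitEigen (lam : ℕ → ℝ) (φ : ℕ → H10 Ω) (j : ℕ) : H10 Ω :=
  (Real.sqrt (1 + lam j))⁻¹ • φ j

theorem IsDirichletEigensystem.inner_H10 (h : IsDirichletEigensystem Ω lam φ) (i j : ℕ) :
    ⟪φ i, φ j⟫ = if i = j then 1 + lam i else 0 := by
  rw [MultiTermDiffusion.inner_H10, (h.eigenpair i).inner_grad,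
    orthonormal_iff_ite.1 h.orthonormal i j]
  split_ifs <;> ring

theorem IsDirichletEigensystem.orthonormal_unitEigen (h : IsDirichletEigensystem Ω lam φ)
    (hlam : ∀ j, 0 < lam j) : Orthonormal ℝ (unitEigen lam φ) := by
  rw [orthonormal_iff_ite]
  intro i j
  have e : ⟪unitEigen lam φ i, unitEigen lam φ j⟫
      = (Real.sqrt (1 + lam i))⁻¹ * ((Real.sqrt (1 + lam j))⁻¹ * ⟪φ i, φ j⟫) :=
    (real_inner_smul_left (F := H10 Ω) _ _ _).trans
      (congrArg _ (real_inner_smul_right (F := H10 Ω) _ _ _))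
  rw [e, h.inner_H10]
  split_ifs with hij
  · subst hij
    have h1 : 0 < 1 + lam i := by linarith [hlam i]
    have h2 := Real.mul_self_sqrt h1.le
    have h3 := Real.sqrt_pos.2 h1
    field_simp
    linarith
  · simp

end Riesz

/-! ### Calculus in `ℓ²` -/

/-- The space `ℓ²` of real sequences. -/
abbrev SeqL2 : Type := lp (fun _ : ℕ => ℝ) 2

theorem memlp_two_iff {f : ℕ → ℝ} : Memℓp f 2 ↔ Summable fun j => f j ^ 2 := by
  rw [memℓp_gen_iff (by norm_num)]
  simp

theorem seqL2_summable (f : SeqL2) : Summable fun j => f j ^ 2 := memlp_two_iff.1 f.2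

theorem seqL2_norm_sq (f : SeqL2) : ‖f‖ ^ 2 = ∑' j, f j ^ 2 := by
  have := lp.norm_rpow_eq_tsum (p := 2) (by norm_num) f
  simpa using this

open Classical in
/-- A square summable sequence as an element of `ℓ²`. -/
noncomputable def toSeqL2 (f : ℕ → ℝ) : SeqL2 := if h : Memℓp f 2 then ⟨f, h⟩ else 0

theorem toSeqL2_apply {f : ℕ → ℝ} (h : Summable fun j => f j ^ 2) (j : ℕ) : toSeqL2 f j = f j := by
  rw [toSeqL2, dif_pos (memlp_two_iff.2 h)]

section Calculus

variable {F : ℕ → ℝ → ℝ} {c B : ℕ → ℝ} {κ : ℝ}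

/-- Families of real functions whose derivatives satisfy `|Fⱼ'(t)| ≤ Bⱼ t^{κ-1}`, with weights `cⱼ`
such that `(Fⱼ cⱼ)` and `(Bⱼ cⱼ)` are square summable. -/
structure IsTamedFamily (F : ℕ → ℝ → ℝ) (c B : ℕ → ℝ) (κ : ℝ) : Prop where
  kappa_pos : 0 < κ
  differentiableAt : ∀ (j : ℕ) (t : ℝ), 0 < t → DifferentiableAt ℝ (F j) t
  deriv_le : ∀ (j : ℕ) (t : ℝ), 0 < t → |deriv (F j) t| ≤ B j * t ^ (κ - 1)
  summable : ∀ t : ℝ, 0 < t → Summable fun j => (F j t * c j) ^ 2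
  summable_bound : Summable fun j => (B j * c j) ^ 2

namespace IsTamedFamily

theorem bound_nonneg (h : IsTamedFamily F c B κ) (j : ℕ) : 0 ≤ B j := by
  have := (abs_nonneg _).trans (h.deriv_le j 1 one_pos)
  simpa using this

theorem deriv_mul_sq_le (h : IsTamedFamily F c B κ) {t : ℝ} (ht : 0 < t) (j : ℕ) :
    (deriv (F j) t * c j) ^ 2 ≤ (t ^ (κ - 1)) ^ 2 * (B j * c j) ^ 2 := by
  have h1 := pow_le_pow_left₀ (abs_nonneg _) (h.deriv_le j t ht) 2
  rw [sq_abs] at h1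
  calc (deriv (F j) t * c j) ^ 2 = (deriv (F j) t) ^ 2 * c j ^ 2 := by ring
    _ ≤ (B j * t ^ (κ - 1)) ^ 2 * c j ^ 2 := by gcongr
    _ = _ := by ring

theorem summable_deriv (h : IsTamedFamily F c B κ) {t : ℝ} (ht : 0 < t) :
    Summable fun j => (deriv (F j) t * c j) ^ 2 :=
  Summable.of_nonneg_of_le (fun _ => sq_nonneg _) (h.deriv_mul_sq_le ht)
    (h.summable_bound.mul_left _)

/-- The squared `ℓ²` distance between slope and derivative is a series whose terms tend to zero. By
the mean value inequality on `[t/2, 2t]`, where `s^(κ-1) ≤ K`, it is dominated by `(2K Bⱼcⱼ)²`. -/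
theorem hasDerivAt (h : IsTamedFamily F c B κ) {t : ℝ} (ht : 0 < t) :
    HasDerivAt (fun s => toSeqL2 fun j => F j s * c j)
      (toSeqL2 fun j => deriv (F j) t * c j) t := by
  set x : ℝ → SeqL2 := fun s => toSeqL2 fun j => F j s * c j
  set y : SeqL2 := toSeqL2 fun j => deriv (F j) t * c j with hy
  obtain ⟨K, hK⟩ := isCompact_Icc.exists_bound_of_continuousOn
    (f := fun s : ℝ => s ^ (κ - 1)) (s := Icc (t / 2) (2 * t))
    (ContinuousOn.rpow_const continuousOn_id fun s hs => Or.inl (by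
      have h1 : t / 2 ≤ s := hs.1
      have h2 : (0 : ℝ) < s := by linarith
      exact h2.ne'))
  have hnear : ∀ᶠ s in 𝓝[≠] t, s ∈ Icc (t / 2) (2 * t) ∧ s ≠ t :=
    Filter.Eventually.and
      (mem_nhdsWithin_of_mem_nhds (Icc_mem_nhds (by linarith) (by linarith))) self_mem_nhdsWithin
  have htI : t ∈ Icc (t / 2) (2 * t) := ⟨by linarith, by linarith⟩
  have hK0 : 0 ≤ K := (norm_nonneg _).trans (hK t htI)
  have hdB : ∀ j, ∀ s ∈ Icc (t / 2) (2 * t), ‖deriv (F j) s‖ ≤ K * B j := by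
    intro j s hs
    have hs0 : 0 < s := by linarith [hs.1]
    have h1 := (le_abs_self _).trans (hK s hs)
    calc ‖deriv (F j) s‖ ≤ B j * s ^ (κ - 1) := h.deriv_le j s hs0
      _ ≤ B j * K := mul_le_mul_of_nonneg_left h1 (h.bound_nonneg j)
      _ = _ := mul_comm _ _
  have hcoord : ∀ s, 0 < s → ∀ j, (slope x t s - y) j = (slope (F j) t s - deriv (F j) t) * c j := by
    intro s hs j
    have h1 : (slope x t s - y) j = (s - t)⁻¹ * (x s j - x t j) - y j := by
      rw [slope_def_module]; rfl
    rw [h1, toSeqL2_apply (h.summable s hs), toSeqL2_apply (h.summable t ht),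
      toSeqL2_apply (h.summable_deriv ht), slope_def_module, smul_eq_mul]
    ring
  have hslope : ∀ s ∈ Icc (t / 2) (2 * t), s ≠ t → ∀ j, |slope (F j) t s| ≤ K * B j := by
    intro s hs hst j
    have h1 := (convex_Icc (t / 2) (2 * t)).norm_image_sub_le_of_norm_deriv_le
      (f := F j) (C := K * B j) (fun r hr => h.differentiableAt j r (by linarith [hr.1]))
      (hdB j) htI hs
    have hst' : 0 < ‖s - t‖ := norm_pos_iff.2 (sub_ne_zero.2 hst)
    rw [slope_def_module, smul_eq_mul, abs_mul, abs_inv, ← Real.norm_eq_abs (s - t),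
      inv_mul_le_iff₀ hst', mul_comm]
    exact h1
  rw [hasDerivAt_iff_tendsto_slope, tendsto_iff_norm_sub_tendsto_zero]
  have hsq : Tendsto (fun s => ‖slope x t s - y‖ ^ 2) (𝓝[≠] t) (𝓝 0) := by
    have hlim : Tendsto (fun s => ∑' j, ((slope (F j) t s - deriv (F j) t) * c j) ^ 2) (𝓝[≠] t)
        (𝓝 (∑' _ : ℕ, (0 : ℝ))) := by
      refine tendsto_tsum_of_dominated_convergence
        (bound := fun j => (2 * K) ^ 2 * (B j * c j) ^ 2) (h.summable_bound.mul_left _) ?_ ?_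
      · intro j
        have h1 := hasDerivAt_iff_tendsto_slope.1 (h.differentiableAt j t ht).hasDerivAt
        have h2 := ((h1.sub_const (deriv (F j) t)).mul_const (c j)).pow 2
        simpa using h2
      · filter_upwards [hnear] with s hs j
        rw [Real.norm_of_nonneg (sq_nonneg _)]
        have h1 : |slope (F j) t s - deriv (F j) t| ≤ 2 * K * B j := by
          have h2 := hslope s hs.1 hs.2 j
          have h3 := hdB j t htI
          rw [Real.norm_eq_abs] at h3
          have := abs_sub (slope (F j) t s) (deriv (F j) t)
          linarith
        have h2 := pow_le_pow_left₀ (abs_nonneg _) h1 2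
        rw [sq_abs] at h2
        calc _ = (slope (F j) t s - deriv (F j) t) ^ 2 * c j ^ 2 := by ring
          _ ≤ (2 * K * B j) ^ 2 * c j ^ 2 := by gcongr
          _ = _ := by ring
    rw [tsum_zero] at hlim
    refine hlim.congr' ?_
    filter_upwards [hnear] with s hs
    rw [seqL2_norm_sq]
    exact tsum_congr fun j => by rw [hcoord s (by linarith [hs.1.1])]
  have := hsq.sqrt
  simpa [Real.sqrt_sq (norm_nonneg _)] using this

theorem deriv_apply (h : IsTamedFamily F c B κ) {t : ℝ} (ht : 0 < t) (j : ℕ) :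
    (deriv (fun s => toSeqL2 fun j => F j s * c j) t) j = deriv (F j) t * c j := by
  rw [(h.hasDerivAt ht).deriv, toSeqL2_apply (h.summable_deriv ht)]

theorem norm_deriv_le (h : IsTamedFamily F c B κ) {t : ℝ} (ht : 0 < t) :
    ‖deriv (fun s => toSeqL2 fun j => F j s * c j) t‖
      ≤ Real.sqrt (∑' j, (B j * c j) ^ 2) * t ^ (κ - 1) := by
  refine (pow_le_pow_iff_left₀ (norm_nonneg _) (by positivity) two_ne_zero).1 ?_
  rw [seqL2_norm_sq, mul_pow, Real.sq_sqrt (tsum_nonneg fun _ => sq_nonneg _), mul_comm,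
    ← tsum_mul_left]
  refine Summable.tsum_le_tsum (fun j => ?_) (seqL2_summable _) (h.summable_bound.mul_left _)
  rw [h.deriv_apply ht]
  exact h.deriv_mul_sq_le ht j

theorem caputoDifferentiableAt (h : IsTamedFamily F c B κ) {β t : ℝ} (hβ : β < 1) (ht : 0 < t) :
    CaputoDifferentiableAt β (fun s => toSeqL2 fun j => F j s * c j) t :=
  ⟨fun _ hτ => (h.hasDerivAt hτ.1).differentiableAt,
    intervalIntegrable_sub_rpow_smul h.kappa_pos hβ ht
      (stronglyMeasurable_deriv _).aestronglyMeasurable fun _ hτ => h.norm_deriv_le hτ.1⟩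

theorem caputoDeriv_apply (h : IsTamedFamily F c B κ) {β t : ℝ} (hβ : β < 1) (ht : 0 < t) (j : ℕ) :
    (caputoDeriv β (fun s => toSeqL2 fun j => F j s * c j) t) j = caputoDeriv β (F j) t * c j := by
  have h1 := (lp.evalCLM ℝ (fun _ : ℕ => ℝ) (p := 2) j).intervalIntegral_comp_comm
    (h.caputoDifferentiableAt hβ ht).2
  have h2 : (caputoDeriv β (fun s => toSeqL2 fun j => F j s * c j) t) j
      = (Real.Gamma (1 - β))⁻¹ * (lp.evalCLM ℝ (fun _ : ℕ => ℝ) (p := 2) j)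
        (∫ τ in (0 : ℝ)..t, (t - τ) ^ (-β) • deriv (fun s => toSeqL2 fun j => F j s * c j) τ) := rfl
  rw [h2, ← h1, caputoDeriv, smul_eq_mul, mul_assoc, ← intervalIntegral.integral_mul_const]
  congr 1
  refine intervalIntegral.integral_congr_ae (ae_of_all _ fun τ hτ => ?_)
  rw [uIoc_of_le ht.le] at hτ
  have h3 : (lp.evalCLM ℝ (fun _ : ℕ => ℝ) (p := 2) j)
      ((t - τ) ^ (-β) • deriv (fun s => toSeqL2 fun j => F j s * c j) τ)
      = (t - τ) ^ (-β) * (deriv (fun s => toSeqL2 fun j => F j s * c j) τ) j := rfl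
  rw [h3, h.deriv_apply hτ.1, smul_eq_mul, mul_assoc]

end IsTamedFamily

end Calculus

/-! ### Caputo derivatives and continuous linear maps -/

section Comp

variable {E E' : Type*} [NormedAddCommGroup E] [NormedSpace ℝ E] [NormedAddCommGroup E']
  [NormedSpace ℝ E'] {x : ℝ → E} {u : ℝ → E'}

/-- Agreement of `u` with `J ∘ x` at positive times suffices, since the Caputo integral sees only
derivatives there. The series representation of the solution is available for exactly those times.
-/
theorem CaputoDifferentiableAt.deriv_clm_comp (J : E →L[ℝ] E') (hu : ∀ t, 0 < t → u t = J (x t))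
    {β t : ℝ} (h : CaputoDifferentiableAt β x t) {τ : ℝ} (hτ : τ ∈ Ioo 0 t) :
    HasDerivAt u (J (deriv x τ)) τ := by
  refine (J.hasFDerivAt.comp_hasDerivAt τ (h.1 τ hτ).hasDerivAt).congr_of_eventuallyEq ?_
  filter_upwards [lt_mem_nhds hτ.1] with s hs using hu s hs

theorem CaputoDifferentiableAt.clm_comp (J : E →L[ℝ] E') (hu : ∀ t, 0 < t → u t = J (x t))
    {β t : ℝ} (ht : 0 < t) (h : CaputoDifferentiableAt β x t) : CaputoDifferentiableAt β u t := by
  refine ⟨fun τ hτ => (h.deriv_clm_comp J hu hτ).differentiableAt, ?_⟩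
  have h1 : IntervalIntegrable (fun τ => J ((t - τ) ^ (-β) • deriv x τ)) volume 0 t := by
    have h2 := h.2
    rw [intervalIntegrable_iff] at h2 ⊢
    exact J.integrable_comp h2
  refine h1.congr_ae ?_
  -- Differentiability is known only on the open interval; the endpoint `t` is a null set.
  rw [uIoc_of_le ht.le, ← restrict_Ioo_eq_restrict_Ioc]
  refine (ae_restrict_mem measurableSet_Ioo).mono fun τ hτ => ?_
  simp only [map_smul, (h.deriv_clm_comp J hu hτ).deriv]

theorem CaputoDifferentiableAt.caputoDeriv_clm_comp [CompleteSpace E] [CompleteSpace E']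
    (J : E →L[ℝ] E')
    (hu : ∀ t, 0 < t → u t = J (x t)) {β t : ℝ} (ht : 0 < t) (h : CaputoDifferentiableAt β x t) :
    caputoDeriv β u t = J (caputoDeriv β x t) := by
  rw [caputoDeriv, caputoDeriv, map_smul, ← J.intervalIntegral_comp_comm h.2]
  congr 1
  rw [intervalIntegral.integral_of_le ht.le, intervalIntegral.integral_of_le ht.le,
    ← restrict_Ioo_eq_restrict_Ioc]
  refine integral_congr_ae ((ae_restrict_mem measurableSet_Ioo).mono fun τ hτ => ?_)
  simp only [map_smul, (h.deriv_clm_comp J hu hτ).deriv]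

end Comp

/-! ### Orthonormal series in the dual of a Hilbert space -/

section Dual

variable {H : Type*} [NormedAddCommGroup H] [InnerProductSpace ℝ H] [CompleteSpace H]

variable (H) in
/-- The Riesz map of a real Hilbert space as a linear map. -/
noncomputable def rieszMap : H →L[ℝ] StrongDual ℝ H where
  toFun := InnerProductSpace.toDual ℝ H
  map_add' := map_add _
  map_smul' c x := by simp
  cont := (InnerProductSpace.toDual ℝ H).continuous

/-- The map `x ↦ ∑ xⱼ ⟨eⱼ, ·⟩` from `ℓ²` to the dual of `H`. -/
noncomputable def dualSeries {e : ℕ → H} (he : Orthonormal ℝ e) : SeqL2 →L[ℝ] StrongDual ℝ H :=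
  (rieszMap H).comp he.orthogonalFamily.linearIsometry.toContinuousLinearMap

theorem hasSum_dualSeries {e : ℕ → H} (he : Orthonormal ℝ e) (x : SeqL2) :
    HasSum (fun j => x j • InnerProductSpace.toDual ℝ H (e j)) (dualSeries he x) := by
  have h := (he.orthogonalFamily.hasSum_linearIsometry x).mapL (rieszMap H)
  refine HasSum.congr_fun h fun j => ?_
  rw [LinearIsometry.toSpanSingleton_apply, map_smul]
  rfl

theorem dualSeries_apply {e : ℕ → H} (he : Orthonormal ℝ e) (x : SeqL2) (j : ℕ) :
    dualSeries he x (e j) = x j := by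
  have h := (hasSum_dualSeries he x).mapL (ContinuousLinearMap.apply ℝ ℝ (e j))
  have h2 : HasSum (fun i => (ContinuousLinearMap.apply ℝ ℝ (e j))
      (x i • InnerProductSpace.toDual ℝ H (e i))) (x j) := by
    refine HasSum.congr_fun (hasSum_ite_eq j (x j)) fun i => ?_
    have : ⟪e i, e j⟫ = if i = j then (1 : ℝ) else 0 := orthonormal_iff_ite.1 he i j
    simp only [ContinuousLinearMap.apply_apply, smul_apply,
      InnerProductSpace.toDual_apply_apply, this, smul_eq_mul]
    split_ifs with hij
    · rw [hij, mul_one]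
    · rw [mul_zero]
  exact h.unique h2

/-- If `A` is a symmetric form with `A eⱼ = aⱼ ⟨eⱼ, ·⟩`, it acts diagonally on orthonormal series. -/
theorem apply_toDual_symm_dualSeries {e : ℕ → H} (he : Orthonormal ℝ e)
    (A : H → StrongDual ℝ H) (hsymm : ∀ w χ, A w χ = A χ w) {a : ℕ → ℝ}
    (ha : ∀ j, A (e j) = a j • InnerProductSpace.toDual ℝ H (e j)) {x y : SeqL2}
    (hxy : ∀ j, x j * a j = y j) :
    A ((InnerProductSpace.toDual ℝ H).symm (dualSeries he x)) = dualSeries he y := by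
  ext χ
  rw [hsymm]
  have h0 : (InnerProductSpace.toDual ℝ H).symm (dualSeries he x)
      = he.orthogonalFamily.linearIsometry x := by
    rw [LinearIsometryEquiv.symm_apply_eq]; rfl
  rw [h0]
  have h := (he.orthogonalFamily.hasSum_linearIsometry x).mapL (A χ)
  have h2 := (hasSum_dualSeries he y).mapL (ContinuousLinearMap.apply ℝ ℝ χ)
  refine h.unique (HasSum.congr_fun h2 fun j => ?_)
  simp only [LinearIsometry.toSpanSingleton_apply, map_smul, smul_eq_mul,
    ContinuousLinearMap.apply_apply]
  rw [hsymm, ha, ← hxy]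
  simp
  ring

end Dual

/-! ### The solution operator -/

section Solution

variable {d : ℕ} {Ω : Set (EuclideanSpace ℝ (Fin d))} {lam : ℕ → ℝ} {φ : ℕ → H10 Ω}

theorem embed_smul (c : ℝ) (w : H10 Ω) : embed (c • w) = c • embed w := by
  ext χ
  simp [embed]

theorem embed_symm (w χ : H10 Ω) : embed w χ = embed χ w := by
  simp [embed, real_inner_comm]

theorem toDual_unitEigen (j : ℕ) :
    InnerProductSpace.toDual ℝ (H10 Ω) (unitEigen lam φ j)
      = (Real.sqrt (1 + lam j))⁻¹ • InnerProductSpace.toDual ℝ (H10 Ω) (φ j) := by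
  ext χ
  exact real_inner_smul_left (F := H10 Ω) _ _ _

theorem IsDirichletEigensystem.embed_eq (h : IsDirichletEigensystem Ω lam φ)
    (hlam : ∀ j, 0 < lam j) (j : ℕ) :
    embed (φ j) = (Real.sqrt (1 + lam j))⁻¹ •
      InnerProductSpace.toDual ℝ (H10 Ω) (unitEigen lam φ j) := by
  have h1 : 0 < 1 + lam j := by linarith [hlam j]
  have h2 := Real.mul_self_sqrt h1.le
  have h3 := Real.sqrt_pos.2 h1
  rw [toDual_unitEigen, (h.eigenpair j).toDual_eq, smul_smul, smul_smul]
  have : (Real.sqrt (1 + lam j))⁻¹ * ((Real.sqrt (1 + lam j))⁻¹ * (1 + lam j)) = 1 := by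
    field_simp
    linarith
  rw [← mul_assoc] at this
  rw [this, one_smul]

theorem IsDirichletEigensystem.embed_unitEigen (h : IsDirichletEigensystem Ω lam φ)
    (hlam : ∀ j, 0 < lam j) (j : ℕ) :
    embed (unitEigen lam φ j) = (1 + lam j)⁻¹ •
      InnerProductSpace.toDual ℝ (H10 Ω) (unitEigen lam φ j) := by
  have h1 : 0 < 1 + lam j := by linarith [hlam j]
  have e : embed (unitEigen lam φ j) = (Real.sqrt (1 + lam j))⁻¹ • embed (φ j) := embed_smul _ _
  rw [e, h.embed_eq hlam, smul_smul, ← mul_inv, Real.mul_self_sqrt h1.le]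

theorem apply_eigen (hlam : ∀ j, 0 < lam j) (f : HNegOne Ω) (j : ℕ) :
    f (φ j) = Real.sqrt (1 + lam j) * f (unitEigen lam φ j) := by
  have h1 : 0 < 1 + lam j := by linarith [hlam j]
  have h3 := Real.sqrt_pos.2 h1
  have e : f (unitEigen lam φ j) = (Real.sqrt (1 + lam j))⁻¹ * f (φ j) := f.map_smul _ _
  rw [e]
  field_simp

theorem summable_apply_unitEigen_sq (he : Orthonormal ℝ (unitEigen lam φ)) (f : HNegOne Ω) :
    Summable fun j => f (unitEigen lam φ j) ^ 2 := by
  have h := he.inner_products_summable ((InnerProductSpace.toDual ℝ (H10 Ω)).symm f)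
  refine h.congr fun j => ?_
  rw [real_inner_comm, InnerProductSpace.toDual_symm_apply, Real.norm_eq_abs, sq_abs]

/-- Both norms are weighted `ℓ²` norms of coefficients, so a uniform bound on each mode transfers
from `Ḣ^q` to `Ḣ^p`. -/
theorem memDotH_and_dotHNorm_le {p q K : ℝ} (hlam : ∀ j, 0 < lam j) (hK : 0 ≤ K)
    {f v : HNegOne Ω} (hv : MemDotH lam φ q v)
    (h : ∀ j, lam j ^ ((p - q) / 2) * |f (φ j)| ≤ K * |v (φ j)|) :
    MemDotH lam φ p f ∧ dotHNorm lam φ p f ≤ K * dotHNorm lam φ q v := by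
  have key : ∀ j, lam j ^ p * f (φ j) ^ 2 ≤ K ^ 2 * (lam j ^ q * v (φ j) ^ 2) := by
    intro j
    have h0 := (hlam j).le
    have hq : 0 ≤ lam j ^ q := Real.rpow_nonneg h0 _
    have h1 := pow_le_pow_left₀ (mul_nonneg (Real.rpow_nonneg h0 _) (abs_nonneg _)) (h j) 2
    rw [mul_pow, mul_pow, sq_abs, sq_abs, ← Real.rpow_natCast (lam j ^ ((p - q) / 2)) 2,
      ← Real.rpow_mul h0] at h1
    have e : lam j ^ p = lam j ^ q * lam j ^ ((p - q) / 2 * ((2 : ℕ) : ℝ)) := by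
      rw [← Real.rpow_add (hlam j)]
      congr 1
      push_cast
      ring
    rw [e, mul_assoc, mul_left_comm (K ^ 2)]
    exact mul_le_mul_of_nonneg_left h1 hq
  have hmem : MemDotH lam φ p f := Summable.of_nonneg_of_le
    (fun j => mul_nonneg (Real.rpow_nonneg (hlam j).le _) (sq_nonneg _)) key (hv.mul_left _)
  refine ⟨hmem, ?_⟩
  rw [dotHNorm, dotHNorm, ← Real.sqrt_sq hK, ← Real.sqrt_mul (sq_nonneg K), ← tsum_mul_left]
  exact Real.sqrt_le_sqrt (Summable.tsum_le_tsum key hmem (hv.mul_left _))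

variable {m : ℕ} {α : ℝ} {αs b : Fin m → ℝ}

/-- The coefficients satisfy `v(eⱼ)² = v(φⱼ)²/(1+λⱼ)`, so `λⱼ^{2θ} v(eⱼ)²` is summable as soon as
`2θ - 1 ≤ q`. The derivative bound requires `θ ≤ 1`, and integrability at `0` requires `θ > 0`;
hence `θ = min(1, (1+q)/2)`. -/
theorem isTamedFamily_modeFactor (hα₀ : 0 < α) (hα₁ : α < 1) (hαs : ∀ i, 0 < αs i ∧ αs i < α)
    (hb : ∀ i, 0 < b i) (hlam : ∀ j, 0 < lam j) (he : Orthonormal ℝ (unitEigen lam φ)) {q : ℝ}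
    (hq : -1 < q) {v : HNegOne Ω} (hv : MemDotH lam φ q v) :
    IsTamedFamily (fun j => modeFactor α αs b (lam j)) (fun j => v (unitEigen lam φ j))
      (fun j => (1 + α / Real.Gamma (α + 1)) * lam j ^ min 1 ((1 + q) / 2))
      (α * min 1 ((1 + q) / 2)) := by
  have hθ₀ : 0 < min 1 ((1 + q) / 2) := lt_min one_pos (by linarith)
  have hθ₁ : min 1 ((1 + q) / 2) ≤ 1 := min_le_left _ _
  have hθ₂ : 2 * min 1 ((1 + q) / 2) - 1 ≤ q := by
    linarith [min_le_right (1 : ℝ) ((1 + q) / 2)]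
  set θ := min 1 ((1 + q) / 2)
  set M := 1 + α / Real.Gamma (α + 1)
  have hc := summable_apply_unitEigen_sq he v
  refine ⟨by positivity, fun j t ht => differentiableAt_modeFactor hα₀ hαs ht,
    fun j t ht => abs_deriv_modeFactor_le hα₀ hα₁ hαs hb (hlam j) hθ₀.le hθ₁ ht,
    fun t ht => ?_, ?_⟩
  · refine Summable.of_nonneg_of_le (fun _ => sq_nonneg _) (fun j => ?_) hc
    have h0 := modeFactor_nonneg hα₀ hα₁ hαs hb (hlam j) ht.le
    have h1 := modeFactor_le_one hα₀ hα₁ hαs hb (hlam j) ht.le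
    rw [mul_pow]
    exact mul_le_of_le_one_left (sq_nonneg _) (pow_le_one₀ h0 h1)
  · refine Summable.of_nonneg_of_le (fun _ => sq_nonneg _) (fun j => ?_)
      ((hc.add hv).mul_left (M ^ 2))
    have hl := hlam j
    have hl1 : 0 < 1 + lam j := by linarith
    have e : (lam j ^ θ) ^ 2 = lam j ^ (2 * θ) := by
      rw [← Real.rpow_natCast, ← Real.rpow_mul hl.le, mul_comm]
      norm_num
    rw [mul_assoc, mul_pow, mul_pow, e]
    refine mul_le_mul_of_nonneg_left ?_ (sq_nonneg M)
    rw [apply_eigen (φ := φ) hlam v j, mul_pow, Real.sq_sqrt hl1.le]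
    set y := v (unitEigen lam φ j) ^ 2
    have hy : 0 ≤ y := sq_nonneg _
    have hlq : 0 ≤ lam j ^ q := Real.rpow_nonneg hl.le _
    -- Modes with `λⱼ ≤ 1` are controlled by the `H⁻¹` part of the majorant, those with `λⱼ ≥ 1` by
    -- its `Ḣ^q` part.
    rcases le_total (lam j) 1 with hle | hle
    · have h1 : lam j ^ (2 * θ) ≤ 1 := Real.rpow_le_one hl.le hle (by linarith)
      have h2 := mul_le_mul_of_nonneg_right h1 hy
      have h3 : 0 ≤ lam j ^ q * ((1 + lam j) * y) := by positivity
      linarith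
    · have h1 : lam j ^ (2 * θ) ≤ lam j ^ q * (1 + lam j) := by
        calc lam j ^ (2 * θ) ≤ lam j ^ (q + 1) :=
              Real.rpow_le_rpow_of_exponent_le hle (by linarith)
          _ = lam j ^ q * lam j := Real.rpow_add_one hl.ne' q
          _ ≤ _ := mul_le_mul_of_nonneg_left (by linarith) hlq
      have h2 := mul_le_mul_of_nonneg_right h1 hy
      linarith

/-- The coordinates of `E(t)v` with respect to the eigenfunctions normalized in `H¹₀(Ω)`. -/
noncomputable def solCoords (α : ℝ) (αs b : Fin m → ℝ) (lam : ℕ → ℝ) (φ : ℕ → H10 Ω)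
    (v : HNegOne Ω) (t : ℝ) : SeqL2 :=
  toSeqL2 fun j => modeFactor α αs b (lam j) t * v (unitEigen lam φ j)

/-- The data of the initial value problem: the orders and coefficients of `P(∂ₜ)`, the eigensystem
and an initial value in `Ḣ^q(Ω)`, `q > -1`. -/
structure IsSolutionSetup (α : ℝ) (αs b : Fin m → ℝ) (lam : ℕ → ℝ) (φ : ℕ → H10 Ω) (q : ℝ)
    (v : HNegOne Ω) : Prop where
  alpha_pos : 0 < α
  alpha_lt : α < 1
  alphas : ∀ i, 0 < αs i ∧ αs i < α
  b_pos : ∀ i, 0 < b i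
  eigensystem : IsDirichletEigensystem Ω lam φ
  lam_pos : ∀ j, 0 < lam j
  lt_q : -1 < q
  memDotH : MemDotH lam φ q v

namespace IsSolutionSetup

variable {q : ℝ} {v : HNegOne Ω} {t : ℝ}

theorem orthonormal (h : IsSolutionSetup α αs b lam φ q v) : Orthonormal ℝ (unitEigen lam φ) :=
  h.eigensystem.orthonormal_unitEigen h.lam_pos

theorem isTamedFamily (h : IsSolutionSetup α αs b lam φ q v) :
    IsTamedFamily (fun j => modeFactor α αs b (lam j)) (fun j => v (unitEigen lam φ j))
      (fun j => (1 + α / Real.Gamma (α + 1)) * lam j ^ min 1 ((1 + q) / 2))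
      (α * min 1 ((1 + q) / 2)) :=
  isTamedFamily_modeFactor h.alpha_pos h.alpha_lt h.alphas h.b_pos h.lam_pos h.orthonormal h.lt_q
    h.memDotH

theorem solCoords_apply (h : IsSolutionSetup α αs b lam φ q v) (ht : 0 < t) (j : ℕ) :
    solCoords α αs b lam φ v t j = modeFactor α αs b (lam j) t * v (unitEigen lam φ j) :=
  toSeqL2_apply (h.isTamedFamily.summable t ht) j

theorem hasSum_solTerm (h : IsSolutionSetup α αs b lam φ q v) (ht : 0 < t) :
    HasSum (solTerm α αs b lam φ v t) (dualSeries h.orthonormal (solCoords α αs b lam φ v t)) := by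
  refine HasSum.congr_fun (hasSum_dualSeries h.orthonormal _) fun j => ?_
  have h1 : 0 < 1 + lam j := by linarith [h.lam_pos j]
  have h3 := Real.sqrt_pos.2 h1
  rw [solTerm, h.solCoords_apply ht, h.eigensystem.embed_eq h.lam_pos, smul_smul,
    apply_eigen (φ := φ) h.lam_pos v j]
  congr 1
  field_simp

theorem solOp_eq (h : IsSolutionSetup α αs b lam φ q v) (ht : 0 < t) :
    solOp α αs b lam φ v t = dualSeries h.orthonormal (solCoords α αs b lam φ v t) :=
  (h.hasSum_solTerm ht).tsum_eq

theorem solOp_apply (h : IsSolutionSetup α αs b lam φ q v) (ht : 0 < t) (j : ℕ) :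
    solOp α αs b lam φ v t (φ j) = modeFactor α αs b (lam j) t * v (φ j) := by
  rw [apply_eigen (φ := φ) h.lam_pos, h.solOp_eq ht, dualSeries_apply,
    h.solCoords_apply ht, apply_eigen (φ := φ) h.lam_pos v]
  ring

theorem caputoDifferentiableAt_solOp (h : IsSolutionSetup α αs b lam φ q v) (ht : 0 < t)
    {β : ℝ} (hβ : β < 1) :
    CaputoDifferentiableAt β (solOp α αs b lam φ v) t :=
  (h.isTamedFamily.caputoDifferentiableAt hβ ht).clm_comp
    (dualSeries h.orthonormal) (fun _ hs => h.solOp_eq hs) ht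

theorem multiTermDeriv_solOp (h : IsSolutionSetup α αs b lam φ q v) (ht : 0 < t) :
    multiTermDeriv α αs b (solOp α αs b lam φ v) t
      = dualSeries h.orthonormal (multiTermDeriv α αs b (solCoords α αs b lam φ v) t) := by
  have htame := h.isTamedFamily
  have key : ∀ β, β < 1 → caputoDeriv β (solOp α αs b lam φ v) t
      = dualSeries h.orthonormal (caputoDeriv β (solCoords α αs b lam φ v) t) := fun β hβ =>
    (htame.caputoDifferentiableAt hβ ht).caputoDeriv_clm_comp (dualSeries h.orthonormal)
      (fun _ hs => h.solOp_eq hs) ht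
  simp only [multiTermDeriv, map_add, map_sum, map_smul, key α h.alpha_lt,
    key _ ((h.alphas _).2.trans h.alpha_lt)]

theorem multiTermDeriv_solCoords_apply (h : IsSolutionSetup α αs b lam φ q v) (ht : 0 < t) (j : ℕ) :
    multiTermDeriv α αs b (solCoords α αs b lam φ v) t j
      = -(lam j * solCoords α αs b lam φ v t j) := by
  have htame := h.isTamedFamily
  have key : ∀ β, β < 1 → caputoDeriv β (solCoords α αs b lam φ v) t j
      = caputoDeriv β (modeFactor α αs b (lam j)) t * v (unitEigen lam φ j) := fun β hβ =>
    htame.caputoDeriv_apply hβ ht j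
  have h1 : multiTermDeriv α αs b (solCoords α αs b lam φ v) t j
      = multiTermDeriv α αs b (modeFactor α αs b (lam j)) t * v (unitEigen lam φ j) := by
    have e : multiTermDeriv α αs b (solCoords α αs b lam φ v) t j
        = caputoDeriv α (solCoords α αs b lam φ v) t j
          + ∑ i, b i * caputoDeriv (αs i) (solCoords α αs b lam φ v) t j := by
      have := map_sum (lp.evalCLM ℝ (fun _ : ℕ => ℝ) (p := 2) j)
        (fun i => b i • caputoDeriv (αs i) (solCoords α αs b lam φ v) t) Finset.univ
      exact congrArg (caputoDeriv α (solCoords α αs b lam φ v) t j + ·) this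
    rw [e, key α h.alpha_lt, multiTermDeriv, add_mul, Finset.sum_mul]
    congr 1
    refine Finset.sum_congr rfl fun i _ => ?_
    rw [key _ ((h.alphas i).2.trans h.alpha_lt), smul_eq_mul, mul_assoc]
  rw [h1, multiTermDeriv_modeFactor h.alpha_pos h.alpha_lt h.alphas ht,
    h.solCoords_apply ht]
  ring

theorem multiTermDeriv_solOp_apply (h : IsSolutionSetup α αs b lam φ q v) (ht : 0 < t) (j : ℕ) :
    multiTermDeriv α αs b (solOp α αs b lam φ v) t (φ j)
      = -(lam j * modeFactor α αs b (lam j) t * v (φ j)) := by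
  rw [apply_eigen (φ := φ) h.lam_pos, h.multiTermDeriv_solOp ht,
    dualSeries_apply, h.multiTermDeriv_solCoords_apply ht,
    h.solCoords_apply ht, apply_eigen (φ := φ) h.lam_pos v]
  ring

/-- The equation suggests `w = (1-Δ)⁻¹(u - P(∂ₜ)u)`. The right side already lies in `H⁻¹(Ω)`, so `w
∈ H¹₀(Ω)` needs no further estimate; in coordinates `xⱼ - zⱼ = (1+λⱼ)xⱼ`, which the embedding maps
back to `xⱼ`. -/
theorem exists_embed_eq_solOp (h : IsSolutionSetup α αs b lam φ q v) (ht : 0 < t) :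
    ∃ w : H10 Ω, embed w = solOp α αs b lam φ v t ∧
      multiTermDeriv α αs b (solOp α αs b lam φ v) t - laplacian w = 0 := by
  set x := solCoords α αs b lam φ v t with hx
  set z := multiTermDeriv α αs b (solCoords α αs b lam φ v) t with hz
  set w := (InnerProductSpace.toDual ℝ (H10 Ω)).symm (dualSeries h.orthonormal (x - z)) with hw
  have h1 : embed w = dualSeries h.orthonormal x := by
    refine apply_toDual_symm_dualSeries h.orthonormal embed embed_symm
      (h.eigensystem.embed_unitEigen h.lam_pos) fun j => ?_
    have h2 : (x - z) j = x j - z j := rfl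
    have h3 : 0 < 1 + lam j := by linarith [h.lam_pos j]
    rw [h2, hz, h.multiTermDeriv_solCoords_apply ht]
    field_simp
    ring
  refine ⟨w, h1.trans (h.solOp_eq ht).symm, ?_⟩
  have h2 : laplacian w = embed w - InnerProductSpace.toDual ℝ (H10 Ω) w := by
    rw [toDual_H10]; abel
  rw [h2, h1, hw, LinearIsometryEquiv.apply_symm_apply,
    h.multiTermDeriv_solOp ht, map_sub]
  abel

end IsSolutionSetup

end Solution

end MultiTermDiffusion

/-! ### The main theorem, assembled from the bounds on the modes. -/

open MultiTermDiffusion in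
theorem theorem2p1 (m : ℕ) (α : ℝ) (αs b : Fin m → ℝ) (T : ℝ)
    (hα₀ : 0 < α) (hα₁ : α < 1) (hαs : ∀ i, 0 < αs i ∧ αs i < α) (hb : ∀ i, 0 < b i)
    (hT : 0 < T) :
    ∃ C : ℝ, 0 < C ∧
      ∀ (d : ℕ), 1 ≤ d → d ≤ 3 →
      ∀ (Ω : Set (EuclideanSpace ℝ (Fin d))), IsConvexPolygonalDomain Ω →
      ∀ (lam : ℕ → ℝ) (φ : ℕ → H10 Ω), IsDirichletEigensystem Ω lam φ →
      ∀ (q : ℝ), -1 < q → q ≤ 2 →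
      ∀ (v : HNegOne Ω), MemDotH lam φ q v →
      -- the series for `E(t)v` converges in `H⁻¹(Ω)` and defines a solution
      (∀ t ∈ Set.Ioc 0 T, Summable (solTerm α αs b lam φ v t)) ∧
      SolvesHomogeneous α αs b T (solOp α αs b lam φ v) ∧
      -- the case `ℓ = 0`
      (∀ p : ℝ, 0 ≤ p - q → p - q ≤ 2 → ∀ t ∈ Set.Ioc 0 T,
        MemDotH lam φ p (solOp α αs b lam φ v t) ∧
        dotHNorm lam φ p (solOp α αs b lam φ v t)
          ≤ C * t ^ (-(α * ((p - q) / 2))) * dotHNorm lam φ q v) ∧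
      -- the case `ℓ = 1`
      (∀ p : ℝ, -2 ≤ p - q → p - q ≤ 0 → ∀ t ∈ Set.Ioc 0 T,
        MemDotH lam φ p (multiTermDeriv α αs b (solOp α αs b lam φ v) t) ∧
        dotHNorm lam φ p (multiTermDeriv α αs b (solOp α αs b lam φ v) t)
          ≤ C * t ^ (-(α * (1 + (p - q) / 2))) * dotHNorm lam φ q v) ∧
      -- the initial condition
      (∀ t ∈ Set.Ioc 0 T, MemDotH lam φ q (solOp α αs b lam φ v t - v)) ∧
      Filter.Tendsto (fun t => dotHNorm lam φ q (solOp α αs b lam φ v t - v))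
        (nhdsWithin 0 (Set.Ioi 0)) (nhds 0) := by
  -- The constant is fixed before the domain, the eigensystem, `p` and `q`, because the scalar bound
  -- is uniform in `λ > 0` and `s ∈ [0, 1]`.
  obtain ⟨C, hC, hbound⟩ := exists_rpow_mul_modeFactor_le hα₀ hα₁ hαs hb T
  refine ⟨C, hC, fun d hd _ Ω hΩ lam φ hsys q hq _ v hv => ?_⟩
  have hlam : ∀ j, 0 < lam j := fun j => (hsys.eigenpair j).pos hd hΩ
  have h : IsSolutionSetup α αs b lam φ q v := ⟨hα₀, hα₁, hαs, hb, hsys, hlam, hq, hv⟩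
  have hF0 : ∀ j (t : ℝ), 0 < t → 0 ≤ modeFactor α αs b (lam j) t := fun j t ht =>
    modeFactor_nonneg hα₀ hα₁ hαs hb (hlam j) ht.le
  have hF1 : ∀ j (t : ℝ), 0 < t → modeFactor α αs b (lam j) t ≤ 1 := fun j t ht =>
    modeFactor_le_one hα₀ hα₁ hαs hb (hlam j) ht.le
  have hdiff : ∀ (t : ℝ), 0 < t → ∀ j, (solOp α αs b lam φ v t - v) (φ j)
      = (modeFactor α αs b (lam j) t - 1) * v (φ j) := fun t ht j => by
    have e : (solOp α αs b lam φ v t - v) (φ j) = solOp α αs b lam φ v t (φ j) - v (φ j) := rfl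
    rw [e, h.solOp_apply ht]
    ring
  have hdiff_le : ∀ (t : ℝ), 0 < t → ∀ j, lam j ^ q * (solOp α αs b lam φ v t - v) (φ j) ^ 2
      ≤ lam j ^ q * v (φ j) ^ 2 := fun t ht j => by
    have h0 := hF0 j t ht
    have h1 := hF1 j t ht
    have h2 : (modeFactor α αs b (lam j) t - 1) ^ 2 ≤ 1 := by nlinarith
    have := Real.rpow_nonneg (hlam j).le q
    rw [hdiff t ht j, mul_pow]
    exact mul_le_mul_of_nonneg_left (mul_le_of_le_one_left (sq_nonneg _) h2) this
  refine ⟨fun t ht => (h.hasSum_solTerm ht.1).summable,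
    fun t ht => ⟨h.caputoDifferentiableAt_solOp ht.1 hα₁,
      fun i => h.caputoDifferentiableAt_solOp ht.1
        ((hαs i).2.trans hα₁),
      h.exists_embed_eq_solOp ht.1⟩,
    fun p hp₀ hp₂ t ht => ?_, fun p hp₂ hp₀ t ht => ?_, fun t ht => ?_, ?_⟩
  · refine memDotH_and_dotHNorm_le hlam (mul_nonneg hC.le (Real.rpow_nonneg ht.1.le _)) hv
      fun j => ?_
    rw [h.solOp_apply ht.1, abs_mul, abs_of_nonneg (hF0 j t ht.1),
      ← mul_assoc]
    exact mul_le_mul_of_nonneg_right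
      (hbound (lam j) (hlam j) _ (by linarith) (by linarith) t ht) (abs_nonneg _)
  · refine memDotH_and_dotHNorm_le hlam (mul_nonneg hC.le (Real.rpow_nonneg ht.1.le _)) hv
      fun j => ?_
    -- The extra `λⱼ` raises the power to `s = 1 + (p-q)/2`, which lies in `[0, 1]` for the present
    -- range of `p`.
    rw [h.multiTermDeriv_solOp_apply ht.1, abs_neg, abs_mul,
      abs_of_nonneg (mul_nonneg (hlam j).le (hF0 j t ht.1)), ← mul_assoc, ← mul_assoc,
      ← Real.rpow_add_one (hlam j).ne', add_comm ((p - q) / 2) 1]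
    exact mul_le_mul_of_nonneg_right
      (hbound (lam j) (hlam j) _ (by linarith) (by linarith) t ht) (abs_nonneg _)
  · exact Summable.of_nonneg_of_le
      (fun j => mul_nonneg (Real.rpow_nonneg (hlam j).le _) (sq_nonneg _)) (hdiff_le t ht.1) hv
  · have hlim : Tendsto (fun t => ∑' j, lam j ^ q * (solOp α αs b lam φ v t - v) (φ j) ^ 2)
        (𝓝[>] 0) (𝓝 (∑' _ : ℕ, (0 : ℝ))) := by
      -- Since each mode factor lies in `[0, 1]`, the `Ḣ^q` series of `v` itself is the majorant.
      refine tendsto_tsum_of_dominated_convergence hv (fun j => ?_) ?_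
      · have h1 := (((tendsto_modeFactor (b := b) (lam := lam j) hα₀ hαs).sub_const 1).mul_const
          (v (φ j))).pow 2 |>.const_mul (lam j ^ q)
        rw [sub_self, zero_mul, zero_pow two_ne_zero, mul_zero] at h1
        refine h1.congr' ?_
        filter_upwards [self_mem_nhdsWithin] with t ht
        rw [hdiff t ht]
      · filter_upwards [self_mem_nhdsWithin] with t ht j
        rw [Real.norm_of_nonneg (mul_nonneg (Real.rpow_nonneg (hlam j).le _) (sq_nonneg _))]
        exact hdiff_le t ht j
    rw [tsum_zero] at hlim
    simpa [dotHNorm] using hlim.sqrt
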